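/- Let $\mathbb N=\{1,2,3,\dots\}$, and for $M\subset\mathbb N$ let $[M]^{<\omega}$ be the set of finite subsets of $M$; put $\min\emptyset=\infty$, and write $A<B$ if $\max A<\min B$. For $\mathcal F\subset[\mathbb N]^{<\omega}$ let $\mathrm{MAX}(\mathcal F)$ be the set of elements of $\mathcal F$ that are maximal with respect to inclusion. **Fundamental sequences.** For every countable ordinal $\xi$ with $\omega^\xi=\xi$ fix an arbitrary sequence $(\beta_{\xi,n})_{n\in\mathbb N}$ in $[0,\xi)$ which increases (not necessarily strictly) to $\xi$. For limit ordinals $\alpha<\omega_1$ define $\lambda(\alpha,n)$, $n\in\mathbb N$, by recursion on $\alpha$. Let $\omega^\xi$ be the leading term of the Cantor normal form of $\alpha$, that is, $\alpha=\omega^\xi+r$ with $\omega^\xi\le\alpha<\omega^{\xi+1}$, and $r<\alpha$. Then $$\lambda(\alpha,n)=\begin{cases}\omega^\xi+\lambda(r,n)&\text{if } r\ne0,\\ \omega^{\zeta}\cdot n&\text{if } r=0,\ \xi=\zeta+1,\\ \omega^{\lambda(\xi,n)}&\text{if } r=0,\ \xi\text{ is a limit ordinal and }\xi<\omega^\xi,\\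 \omega^{\beta_{\xi,n}}&\text{if } r=0,\ \xi=\omega^\xi.\end{cases}$$ For a limit ordinal $\alpha<\omega_1$ let $\mu(\alpha,n)=\lambda(\alpha,n)$ if $\alpha<\omega^\alpha$ and $\mu(\alpha,n)=\beta_{\alpha,n}$ if $\alpha=\omega^\alpha$; thus $\lambda(\omega^\alpha,n)=\omega^{\mu(\alpha,n)}$. **Schreier families.** Let $\mathcal F_0=\{\emptyset\}$, $\mathcal F_{\alpha+1}=\{\{n\}\cup A: n\in\mathbb N,\ A\in\mathcal F_\alpha\}\cup\{\emptyset\}$, and $\mathcal F_\alpha=\{A\in[\mathbb N]^{<\omega}:\exists n\le\min A,\ A\in\mathcal F_{\lambda(\alpha,n)}\}$ if $\alpha<\omega_1$ is a limit ordinal. Put $\mathcal S_\alpha=\mathcal F_{\omega^\alpha}$ for $\alpha<\omega_1$. **Repeated averages.** For $\alpha<\omega_1$ and $A\in\mathrm{MAX}(\mathcal S_\alpha)$ the probability measure $\mathbb P_{(\alpha,A)}$ on $A$ is defined by recursion on $\alpha$. * $\mathbb P_{(0,\{n\})}=\delta_n$. * If $A\in\mathrm{MAX}(\mathcal S_{\alpha+1})$,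 then $A=\bigcup_{j=1}^nA_j$ for unique $A_1<\dots<A_n$ in $\mathrm{MAX}(\mathcal S_\alpha)$ with $n=\min A$, and $\mathbb P_{(\alpha+1,A)}=\frac1n\sum_{j=1}^n\mathbb P_{(\alpha,A_j)}$. * If $\alpha$ is a limit ordinal and $A\in\mathrm{MAX}(\mathcal S_\alpha)$, then $m=\min\{n\le\min A: A\in\mathcal S_{\mu(\alpha,n)}\}$ exists, $A\in\mathrm{MAX}(\mathcal S_{\mu(\alpha,m)})$, and $\mathbb P_{(\alpha,A)}=\mathbb P_{(\mu(\alpha,m),A)}$. Let $\mathbb E_{(\alpha,A)}$ denote the expectation with respect to $\mathbb P_{(\alpha,A)}$. **Cantor–Bendixson index.** For $\mathcal F\subset[\mathbb N]^{<\omega}$ let $\mathcal F'$ be the set of all $A\in[\mathbb N]^{<\omega}$ for which there are infinitely many $n\in\mathbb N$, larger than all elements of $A$, with $A\cup\{n\}\in\mathcal F$. Let $\mathcal F^{(0)}=\mathcal F$, $\mathcal F^{(\alpha+1)}=(\mathcal F^{(\alpha)})'$, and $\mathcal F^{(\alpha)}=\bigcap_{\gamma<\alpha}\mathcal F^{(\gamma)}$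 for limit ordinals $\alpha$. Let $\mathrm{CB}(\mathcal F)$ be the least $\alpha<\omega_1$ with $\mathcal F^{(\alpha)}=\emptyset$ if there is one, and $\mathrm{CB}(\mathcal F)=\omega_1$ otherwise. **Corollary 4.12.** Let $\alpha<\omega_1$ and $\rho\in[-1,1]$, and for each $A\in\mathrm{MAX}(\mathcal S_\alpha)$ let $f_A:A\to[-1,1]$ satisfy $\mathbb E_{(\alpha,A)}(f_A)\ge\rho$. For $\delta>0$ and an infinite set $M\subset\mathbb N$ put $$\mathcal A_{\delta,M}=\Big\{A\in\mathcal S_\alpha\cap[M]^{<\omega}:\ \exists B\in\mathrm{MAX}(\mathcal S_\alpha\cap[M]^{<\omega}),\ A\subset B\text{ and } f_B(a)\ge\rho-\delta\text{ for all }a\in A\Big\}.$$ Then $\mathrm{CB}(\mathcal A_{\delta,M})=\omega^\alpha+1$ for all $\delta>0$ and all infinite $M\subset\mathbb N$. -/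

import Mathlib

open Ordinal

/-!
Throughout, the natural numbers are `ℕ+ = {1, 2, 3, …}`, families of finite sets are of type
`Set (Finset ℕ+)`, and ordinals are of type `Ordinal.{0}`, which contains all `α < ω₁`.
-/

namespace Schreier

/-- `β ξ` is, for every countable ordinal `ξ` with `ω ^ ξ = ξ`, a sequence in `[0, ξ)` which
increases to `ξ`. The values `β ξ` at other ordinals `ξ` are never used. -/
def IsEpsilonSeq (β : Ordinal.{0} → ℕ+ → Ordinal.{0}) : Prop :=
  ∀ ξ < ω₁, ω ^ ξ = ξ →
    Monotone (β ξ) ∧ (∀ n, β ξ n < ξ) ∧ (∀ η < ξ, ∃ n, η < β ξ n)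

/-- Removing the leading term of the Cantor normal form makes a nonzero ordinal smaller. -/
theorem sub_opow_log_lt {α : Ordinal.{0}} (hα : α ≠ 0) : α - ω ^ log ω α < α := by
  refine lt_of_le_of_ne (Ordinal.sub_le_self _ _) fun h => ?_
  have h1 : ω ^ log ω α + (α - ω ^ log ω α) = α :=
    Ordinal.add_sub_cancel_of_le (opow_log_le_self ω hα)
  rw [h] at h1
  have h2 := add_eq_right_iff_mul_omega0_le.1 h1
  have h3 := lt_opow_succ_log_self one_lt_omega0 α
  rw [opow_succ] at h3
  exact absurd h2 (not_le.2 h3)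

open Classical in
/-- The fundamental sequence `λ(α, n)`, `n = 1, 2, …`, of a countable limit ordinal `α`
(the value at an ordinal which is not a limit is irrelevant). If `ω ^ ξ` is the leading term of
`α`, that is `ξ = log ω α`, and `ρ = α - ω ^ ξ` is the remainder, so that `α = ω ^ ξ + ρ`, then
* `λ(α, n) = ω ^ ξ + λ(ρ, n)` if `ρ ≠ 0`;
* `λ(ω ^ (ζ + 1), n) = ω ^ ζ * n`;
* `λ(ω ^ ξ, n) = ω ^ λ(ξ, n)` if `ξ` is a limit ordinal and `ξ < ω ^ ξ`;
* `λ(ω ^ ξ, n) = ω ^ (β ξ n)` if `ξ = ω ^ ξ`. -/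
noncomputable def fundSeq (β : Ordinal.{0} → ℕ+ → Ordinal.{0}) (α : Ordinal.{0}) (n : ℕ+) :
    Ordinal.{0} :=
  if _h0 : α = 0 then 0
  else if _hρ : α - ω ^ log ω α ≠ 0 then
    ω ^ log ω α + fundSeq β (α - ω ^ log ω α) n
  else if ∃ ζ, log ω α = ζ + 1 then
    ω ^ Ordinal.pred (log ω α) * ((n : ℕ) : Ordinal)
  else if _hξ : log ω α < ω ^ log ω α then
    ω ^ fundSeq β (log ω α) n
  else
    ω ^ β (log ω α) n
termination_by α
decreasing_by
  · exact sub_opow_log_lt _h0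
  · exact lt_of_lt_of_le _hξ (opow_log_le_self ω _h0)

/-- The fine Schreier families: `F 0 = {∅}`, `F (α + 1) = {{n} ∪ A : n ∈ ℕ, A ∈ F α} ∪ {∅}`, and
`F α = {A : ∃ n ≤ min A, A ∈ F (λ(α, n))}` for limit ordinals `α`, with `min ∅ = ∞`.
The proviso `λ(α, n) < α` is automatic for countable limit ordinals. -/
noncomputable def fine (β : Ordinal.{0} → ℕ+ → Ordinal.{0}) (α : Ordinal.{0}) :
    Set (Finset ℕ+) :=
  limitRecOn α
    {∅}
    (fun _ F => {B | ∃ n : ℕ+, ∃ A ∈ F, B = insert n A} ∪ {∅})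
    (fun α _ F => {A | ∃ n : ℕ+, (∀ a ∈ A, n ≤ a) ∧
      ∃ h : fundSeq β α n < α, A ∈ F (fundSeq β α n) h})

/-- The Schreier family of order `α`, which is the fine Schreier family of order `ω ^ α`. -/
noncomputable def schreier (β : Ordinal.{0} → ℕ+ → Ordinal.{0}) (α : Ordinal.{0}) :
    Set (Finset ℕ+) :=
  fine β (ω ^ α)

/-- `MAX F`: the elements of the family `F` that are maximal with respect to inclusion. -/
def maxFam (F : Set (Finset ℕ+)) : Set (Finset ℕ+) :=
  {A | Maximal (· ∈ F) A}

/-- `F ∩ [M]^{<ω}`: the elements of the family `F` that are subsets of `M`. -/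
def restrict (F : Set (Finset ℕ+)) (M : Set ℕ+) : Set (Finset ℕ+) :=
  {A | A ∈ F ∧ (A : Set ℕ+) ⊆ M}

/-- For a limit ordinal `α`, the ordinals `μ(α, n)` with `λ(ω ^ α, n) = ω ^ μ(α, n)`. Thus
`A ∈ schreier β α` if and only if `A ∈ schreier β (μ(α, n))` for some `n ≤ min A`. -/
noncomputable def schreierSeq (β : Ordinal.{0} → ℕ+ → Ordinal.{0}) (α : Ordinal.{0}) (n : ℕ+) :
    Ordinal.{0} :=
  open Classical in if α < ω ^ α then fundSeq β α n else β α n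

/-- `A = E₁ ∪ … ∪ Eₙ` with `n = min A`, `E₁ < … < Eₙ` and `E₁, …, Eₙ` in `MAX F`. -/
structure IsBlockDecomp (F : Set (Finset ℕ+)) (A : Finset ℕ+) (n : ℕ+)
    (E : Fin (n : ℕ) → Finset ℕ+) : Prop where
  isLeast : IsLeast (A : Set ℕ+) n
  mem_max : ∀ j, E j ∈ maxFam F
  lt : ∀ i j, i < j → ∀ a ∈ E i, ∀ b ∈ E j, a < b
  union_eq : Finset.univ.biUnion E = A

open Classical in
/-- The weights `p_{(α, A)}(a)` of the repeated averages measures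
`P_{(α, A)} = ∑_{a ∈ A} p_{(α, A)}(a) δ_a`, for `A ∈ MAX (schreier β α)`:
* `P_{(0, {n})} = δ_n`;
* `P_{(α + 1, A)} = (1 / n) ∑_{j ≤ n} P_{(α, E j)}`, where `A = E₁ ∪ … ∪ Eₙ` is the (unique)
  decomposition of `A` with `n = min A` and `E₁ < … < Eₙ` in `MAX (schreier β α)`;
* `P_{(α, A)} = P_{(μ(α, m), A)}` for limit ordinals `α`, where `m` is the smallest `n ≤ min A`
  with `A ∈ schreier β (μ(α, n))`.
The proviso `μ(α, n) < α` is automatic for countable limit ordinals. -/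
noncomputable def weight (β : Ordinal.{0} → ℕ+ → Ordinal.{0}) (α : Ordinal.{0}) :
    Finset ℕ+ → ℕ+ → ℝ :=
  limitRecOn α
    (fun A a => if a ∈ A then 1 else 0)
    (fun α p A a =>
      if h : ∃ (n : ℕ+) (E : Fin (n : ℕ) → Finset ℕ+), IsBlockDecomp (schreier β α) A n E then
        (1 / ((h.choose : ℕ) : ℝ)) * ∑ j, p (h.choose_spec.choose j) a
      else 0)
    (fun α _ p A a =>
      if h : ∃ n : ℕ+, schreierSeq β α n < α ∧ (∀ b ∈ A, n ≤ b) ∧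
          A ∈ schreier β (schreierSeq β α n) then
        p (schreierSeq β α (PNat.find h)) (PNat.find_spec h).1 A a
      else 0)

/-- The expectation `E_{(α, A)}(g)` of `g : A → ℝ` with respect to `P_{(α, A)}`. -/
noncomputable def expect (β : Ordinal.{0} → ℕ+ → Ordinal.{0}) (α : Ordinal.{0})
    (A : Finset ℕ+) (g : ℕ+ → ℝ) : ℝ :=
  ∑ a ∈ A, weight β α A a * g a

/-- The Cantor–Bendixson derivative of a family `F`: the sets `A` for which there are infinitely
many `n > max A` with `A ∪ {n} ∈ F`. -/
def cbDeriv (F : Set (Finset ℕ+)) : Set (Finset ℕ+) :=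
  {A | {n : ℕ+ | (∀ a ∈ A, a < n) ∧ insert n A ∈ F}.Infinite}

/-- The iterated derivatives `F^(α)`. -/
noncomputable def cbIter (F : Set (Finset ℕ+)) (α : Ordinal.{0}) : Set (Finset ℕ+) :=
  limitRecOn α F (fun _ G => cbDeriv G) (fun α _ G => {A | ∀ γ, ∀ h : γ < α, A ∈ G γ h})

/-- The Cantor–Bendixson index `CB(F)`: the least `α < ω₁` with `F^(α) = ∅` if there is one, and
`ω₁` otherwise. -/
noncomputable def cbIndex (F : Set (Finset ℕ+)) : Ordinal.{0} :=
  sInf {α | cbIter F α = ∅ ∨ α = ω₁}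

/-- The family of all `A ∈ schreier β α ∩ [M]^{<ω}` which are contained in some
`B ∈ MAX (schreier β α ∩ [M]^{<ω})` such that `f_B ≥ ρ - δ` on `A`. -/
def largeFam (β : Ordinal.{0} → ℕ+ → Ordinal.{0}) (α : Ordinal.{0})
    (f : Finset ℕ+ → ℕ+ → ℝ) (ρ δ : ℝ) (M : Set ℕ+) : Set (Finset ℕ+) :=
  {A | A ∈ restrict (schreier β α) M ∧
    ∃ B ∈ maxFam (restrict (schreier β α) M), A ⊆ B ∧ ∀ a ∈ A, ρ - δ ≤ f B a}

end Schreier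

namespace Schreier

open Order

variable {β : Ordinal.{0} → ℕ+ → Ordinal.{0}}

/-! ### Countable ordinals and fundamental sequences -/

/-! The upper bound holds because the family lies in `schreier β α = fine β (ω ^ α)`, and the
derivative of order `γ` of `fine β γ` contains no nonempty set (`notMem_cbIter_fine`), so one more
derivative is empty.

For the lower bound it must be shown that `∅` survives `ω ^ α` derivatives. If it did not,
`exists_isSmallOn` would give an infinite `N ⊆ M` such that, for every maximal Schreier set `B ⊆ N`,
each member of the family inside `B` has `P_{(α, B)}`-mass below `δ / (2 + δ)`. But `{a ∈ B | ρ - δ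
≤ f B a}` is such a member, and its mass is at least `δ / (2 + δ)` by a Markov-type estimate
(`le_mass_filter`).

The core is `exists_isSmallOn`, proved by induction on `α` for all hereditary `F` with `∅ ∉ F^(ω ^
α)`. At a successor `α + 1`, some `F^(ω ^ α * k)` is already empty. Revealing `A ∈ F` block by block
along `B = E₁ ∪ … ∪ Eₙ`, the number of derivatives `F^(ω ^ α * i)` containing the revealed part can
drop at most `k` times. At any other block after the first, the new piece lies in a family to which
the induction hypothesis applies, hence has mass below `ε / 2`. The average over blocks is then at
most `(k + 1) / n + ε / 2`, which is below `ε` for large `n`. At a limit, the measure on `B` is one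
of finitely many non-limit order, determined by `min B`. Orders that are too small cannot occur, and
for an order `ζ + 1` the hypothesis at `ζ` controls all blocks but the first. In both cases a
diagonal argument handles the dependence on the points already chosen. -/

theorem opow_lt_omega_one {α : Ordinal.{0}} (hα : α < ω₁) : ω ^ α < ω₁ :=
  isPrincipal_opow_omega 1 omega0_lt_omega_one hα

theorem add_one_lt_omega_one {α : Ordinal.{0}} (hα : α < ω₁) : α + 1 < ω₁ :=
  (Cardinal.isSuccLimit_omega 1).succ_lt hα

theorem isSuccLimit_omega0_opow {α : Ordinal.{0}} (hα : α ≠ 0) : IsSuccLimit (ω ^ α) :=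
  isSuccLimit_opow_left isSuccLimit_omega0 hα

theorem zero_or_add_one_or_isSuccLimit (α : Ordinal.{0}) :
    α = 0 ∨ (∃ ζ, α = ζ + 1) ∨ IsSuccLimit α := by
  rcases zero_or_succ_or_isSuccLimit α with h | ⟨ζ, h⟩ | h
  · exact Or.inl h
  · exact Or.inr (Or.inl ⟨ζ, by rw [← h, succ_eq_add_one]⟩)
  · exact Or.inr (Or.inr h)

theorem not_isSuccLimit_add_one (ζ : Ordinal.{0}) : ¬ IsSuccLimit (ζ + 1) := by
  rw [← succ_eq_add_one]
  exact fun h => not_isSuccPrelimit_succ ζ h.isSuccPrelimit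

/-- A limit ordinal according to its Cantor normal form. -/
theorem isSuccLimit_cases {α : Ordinal.{0}} (hα : IsSuccLimit α) :
    (∃ ξ r : Ordinal.{0}, IsSuccLimit r ∧ r < ω ^ (ξ + 1) ∧ r < α ∧ α = ω ^ ξ + r) ∨
      (∃ ζ : Ordinal.{0}, α = ω ^ (ζ + 1)) ∨ ∃ ξ : Ordinal.{0}, IsSuccLimit ξ ∧ ξ ≤ α ∧ α = ω ^ ξ := by
  have h0 : α ≠ 0 := hα.ne_bot
  have h1 : ω ^ log ω α + (α - ω ^ log ω α) = α :=
    Ordinal.add_sub_cancel_of_le (opow_log_le_self ω h0)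
  by_cases hr : α - ω ^ log ω α = 0
  · rw [hr, add_zero] at h1
    right
    rcases zero_or_add_one_or_isSuccLimit (log ω α) with h | ⟨ζ, h⟩ | h
    · rw [h, opow_zero] at h1
      rw [← h1, ← zero_add 1] at hα
      exact absurd hα (not_isSuccLimit_add_one 0)
    · exact Or.inl ⟨ζ, by rw [← h, h1]⟩
    · refine Or.inr ⟨_, h, ?_, h1.symm⟩
      conv_rhs => rw [← h1]
      exact right_le_opow _ one_lt_omega0
  · refine Or.inl ⟨log ω α, α - ω ^ log ω α, ?_, ?_, sub_opow_log_lt h0, h1.symm⟩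
    · rw [← h1] at hα
      rcases isSuccLimit_add_iff.1 hα with h | h
      · exact h
      · exact absurd h.1 hr
    · exact (sub_opow_log_lt h0).trans (by simpa using lt_opow_succ_log_self one_lt_omega0 α)

theorem log_opow_add {ξ r : Ordinal.{0}} (hr : r < ω ^ (ξ + 1)) : log ω (ω ^ ξ + r) = ξ := by
  have hp : ω ^ ξ < ω ^ (ξ + 1) :=
    (opow_lt_opow_iff_right one_lt_omega0).2 (by simp)
  rw [log_eq_iff one_lt_omega0]
  · exact ⟨le_self_add, isPrincipal_add_omega0_opow _ hp hr⟩
  · exact ((opow_pos ξ omega0_pos).trans_le le_self_add).ne'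

theorem fundSeq_add {ξ r : Ordinal.{0}} (hr : r < ω ^ (ξ + 1)) (h0 : r ≠ 0) (n : ℕ+) :
    fundSeq β (ω ^ ξ + r) n = ω ^ ξ + fundSeq β r n := by
  have h1 : ω ^ ξ + r ≠ 0 := ((opow_pos ξ omega0_pos).trans_le le_self_add).ne'
  rw [fundSeq, dif_neg h1, log_opow_add hr, Ordinal.add_sub_cancel, dif_pos h0]

theorem fundSeq_opow_add_one (ζ : Ordinal.{0}) (n : ℕ+) :
    fundSeq β (ω ^ (ζ + 1)) n = ω ^ ζ * ((n : ℕ) : Ordinal) := by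
  have h1 : ω ^ (ζ + 1) ≠ 0 := (opow_pos _ omega0_pos).ne'
  rw [fundSeq, dif_neg h1, log_opow one_lt_omega0, Ordinal.sub_self, dif_neg (by simp),
    if_pos ⟨ζ, rfl⟩, pred_add_one]

theorem fundSeq_opow {ξ : Ordinal.{0}} (hξ : IsSuccLimit ξ) (n : ℕ+) :
    fundSeq β (ω ^ ξ) n = ω ^ schreierSeq β ξ n := by
  have h1 : ω ^ ξ ≠ 0 := (opow_pos _ omega0_pos).ne'
  have h2 : ¬ ∃ ζ, ξ = ζ + 1 := by
    rintro ⟨ζ, rfl⟩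
    exact not_isSuccLimit_add_one ζ hξ
  rw [fundSeq, dif_neg h1, log_opow one_lt_omega0, Ordinal.sub_self, dif_neg (by simp),
    if_neg h2, schreierSeq]
  split_ifs <;> rfl

/-- The assumption on `fundSeq` is restricted to `ξ < ω ^ ξ` so that an induction below `ω ^ ξ` can
supply it; at fixed points of `ω ^ ·` the sequence `β` takes over. -/
theorem schreierSeq_lt_and_cofinal_of_fundSeq (hβ : IsEpsilonSeq β) {ξ : Ordinal.{0}}
    (hξ : ξ < ω₁)
    (H : ξ < ω ^ ξ → (∀ n, fundSeq β ξ n < ξ) ∧ ∀ η < ξ, ∃ n, η < fundSeq β ξ n) :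
    (∀ n, schreierSeq β ξ n < ξ) ∧ ∀ η < ξ, ∃ n, η < schreierSeq β ξ n := by
  unfold schreierSeq
  split_ifs with h
  · exact H h
  · exact (hβ ξ hξ (le_antisymm (not_lt.1 h) (right_le_opow _ one_lt_omega0))).2

theorem fundSeq_lt_and_cofinal (hβ : IsEpsilonSeq β) (α : Ordinal.{0}) (h1 : α < ω₁)
    (hα : IsSuccLimit α) : (∀ n, fundSeq β α n < α) ∧ ∀ η < α, ∃ n, η < fundSeq β α n := by
  induction α using WellFoundedLT.induction with
  | ind α ih =>
  rcases isSuccLimit_cases hα with ⟨ξ, r, hr, hr1, hrα, rfl⟩ | ⟨ζ, rfl⟩ | ⟨ξ, hξ, hle, rfl⟩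
  · obtain ⟨ha, hb⟩ := ih r hrα (hrα.trans h1) hr
    have hr0 : r ≠ 0 := hr.ne_bot
    simp only [fundSeq_add hr1 hr0]
    refine ⟨fun n => (add_lt_add_iff_left _).2 (ha n), fun η hη => ?_⟩
    obtain ⟨d, hd, hle⟩ := (lt_add_iff hr0).1 hη
    obtain ⟨n, hn⟩ := hb d hd
    exact ⟨n, hle.trans_lt ((add_lt_add_iff_left _).2 hn)⟩
  · simp only [fundSeq_opow_add_one]
    rw [opow_add_one]
    refine ⟨fun n => mul_lt_mul_of_pos_left (natCast_lt_omega0 _) (opow_pos _ omega0_pos),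
      fun η hη => ?_⟩
    obtain ⟨c, hc, hηc⟩ := (lt_mul_iff_of_isSuccLimit isSuccLimit_omega0).1 hη
    obtain ⟨k, rfl⟩ := lt_omega0.1 hc
    refine ⟨k.succPNat, hηc.trans_le ?_⟩
    gcongr
    simp
  · have hξ1 : ξ < ω₁ := hle.trans_lt h1
    obtain ⟨ha, hb⟩ := schreierSeq_lt_and_cofinal_of_fundSeq hβ hξ1
      fun h => ih ξ h hξ1 hξ
    simp only [fundSeq_opow hξ]
    refine ⟨fun n => (opow_lt_opow_iff_right one_lt_omega0).2 (ha n), fun η hη => ?_⟩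
    obtain ⟨c, hc, hηc⟩ := (lt_opow_of_isSuccLimit omega0_ne_zero hξ).1 hη
    obtain ⟨n, hn⟩ := hb c hc
    exact ⟨n, hηc.trans ((opow_lt_opow_iff_right one_lt_omega0).2 hn)⟩

theorem fundSeq_lt (hβ : IsEpsilonSeq β) {α : Ordinal.{0}} (h1 : α < ω₁)
    (hα : IsSuccLimit α) (n : ℕ+) : fundSeq β α n < α :=
  (fundSeq_lt_and_cofinal hβ α h1 hα).1 n

theorem exists_lt_fundSeq (hβ : IsEpsilonSeq β) {α η : Ordinal.{0}} (h1 : α < ω₁)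
    (hα : IsSuccLimit α) (hη : η < α) : ∃ n, η < fundSeq β α n :=
  (fundSeq_lt_and_cofinal hβ α h1 hα).2 η hη

theorem schreierSeq_lt (hβ : IsEpsilonSeq β) {α : Ordinal.{0}} (h1 : α < ω₁)
    (hα : IsSuccLimit α) (n : ℕ+) : schreierSeq β α n < α :=
  (schreierSeq_lt_and_cofinal_of_fundSeq hβ h1
    fun _ => fundSeq_lt_and_cofinal hβ α h1 hα).1 n

/-! ### The fine Schreier families -/

theorem fine_zero : fine β 0 = {∅} := by
  simp [fine]

theorem fine_add_one (α : Ordinal.{0}) :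
    fine β (α + 1) = {B | ∃ n : ℕ+, ∃ A ∈ fine β α, B = insert n A} ∪ {∅} := by
  simp [fine]

theorem mem_fine_limit (hβ : IsEpsilonSeq β) {α : Ordinal.{0}} (h1 : α < ω₁)
    (hα : IsSuccLimit α) {A : Finset ℕ+} :
    A ∈ fine β α ↔ ∃ n : ℕ+, (∀ a ∈ A, n ≤ a) ∧ A ∈ fine β (fundSeq β α n) := by
  rw [fine, limitRecOn_limit _ _ _ _ hα]
  exact ⟨fun ⟨n, h, _, h'⟩ => ⟨n, h, h'⟩, fun ⟨n, h, h'⟩ => ⟨n, h, fundSeq_lt hβ h1 hα n, h'⟩⟩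

/-- Induction on countable ordinals. -/
@[elab_as_elim]
theorem countable_induction {p : ∀ α : Ordinal.{0}, α < ω₁ → Prop} (α : Ordinal.{0})
    (hα : α < ω₁) (zero : p 0 (omega_pos 1))
    (add_one : ∀ (α) (h : α + 1 < ω₁), p α ((lt_add_one α).trans h) → p (α + 1) h)
    (limit : ∀ (α) (h : α < ω₁), IsSuccLimit α → (∀ (ζ) (h' : ζ < α), p ζ (h'.trans h)) → p α h) :
    p α hα := by
  induction α using limitRecOn with
  | zero => exact zero
  | add_one α ih => exact add_one α hα (ih ((lt_add_one α).trans hα))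
  | limit α h ih => exact limit α hα h fun ζ hζ => ih ζ hζ _

theorem fine_hereditary (hβ : IsEpsilonSeq β) {α : Ordinal.{0}} (hα : α < ω₁) :
    ∀ A ∈ fine β α, ∀ B ⊆ A, B ∈ fine β α := by
  induction α, hα using countable_induction with
  | zero =>
    rw [fine_zero]
    rintro A rfl B hB
    exact Finset.subset_empty.1 hB
  | add_one α h ih =>
    rw [fine_add_one]
    rintro A (⟨n, A, hA, rfl⟩ | rfl) B hB
    · rcases B.eq_empty_or_nonempty with rfl | ⟨b, hb⟩
      · exact Or.inr rfl
      by_cases hn : n ∈ B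
      · exact Or.inl ⟨n, B.erase n, ih A hA _ (Finset.subset_insert_iff.1 hB), (Finset.insert_erase hn).symm⟩
      · have : B ⊆ A := (Finset.subset_insert_iff_of_notMem hn).1 hB
        exact Or.inl ⟨b, B.erase b, ih A hA _ ((Finset.erase_subset _ _).trans this),
          (Finset.insert_erase hb).symm⟩
    · exact Or.inr (Finset.subset_empty.1 hB)
  | limit α h1 h ih =>
    intro A hA B hB
    rw [mem_fine_limit hβ h1 h] at hA ⊢
    obtain ⟨n, hn, hA⟩ := hA
    exact ⟨n, fun a ha => hn a (hB ha), ih _ (fundSeq_lt hβ h1 h n) A hA B hB⟩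

theorem empty_mem_fine (hβ : IsEpsilonSeq β) {α : Ordinal.{0}} (hα : α < ω₁) :
    ∅ ∈ fine β α := by
  induction α, hα using countable_induction with
  | zero => simp [fine_zero]
  | add_one α h ih => simp [fine_add_one]
  | limit α h1 h ih =>
    exact (mem_fine_limit hβ h1 h).2 ⟨1, by simp, ih _ (fundSeq_lt hβ h1 h 1)⟩

theorem fine_subset_add_one (hβ : IsEpsilonSeq β) {α : Ordinal.{0}} (hα : α < ω₁) :
    fine β α ⊆ fine β (α + 1) := by
  intro A hA
  rw [fine_add_one]
  rcases A.eq_empty_or_nonempty with rfl | ⟨a, ha⟩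
  · exact Or.inr rfl
  · exact Or.inl ⟨a, A.erase a, fine_hereditary hβ hα A hA _ (Finset.erase_subset _ _),
      (Finset.insert_erase ha).symm⟩

theorem insert_mem_fine_add_one {α : Ordinal.{0}} {A : Finset ℕ+} (hA : A ∈ fine β α) (n : ℕ+) :
    insert n A ∈ fine β (α + 1) := by
  rw [fine_add_one]
  exact Or.inl ⟨n, A, hA, rfl⟩

/-- The families `fine β α` are spreading. -/
theorem image_mem_fine (hβ : IsEpsilonSeq β) {α : Ordinal.{0}} (hα : α < ω₁) (φ : ℕ+ → ℕ+)
    (hφ : ∀ a, a ≤ φ a) : ∀ A ∈ fine β α, A.image φ ∈ fine β α := by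
  induction α, hα using countable_induction with
  | zero => simp [fine_zero]
  | add_one α h ih =>
    intro A hA
    rw [fine_add_one] at hA
    rcases hA with ⟨n, A, hA, rfl⟩ | rfl
    · rw [Finset.image_insert]
      exact insert_mem_fine_add_one (ih A hA) _
    · simpa using empty_mem_fine hβ h
  | limit α h1 h ih =>
    intro A hA
    obtain ⟨n, hn, hA⟩ := (mem_fine_limit hβ h1 h).1 hA
    refine (mem_fine_limit hβ h1 h).2 ⟨n, fun b hb => ?_, ih _ (fundSeq_lt hβ h1 h n) A hA⟩
    obtain ⟨a, ha, rfl⟩ := Finset.mem_image.1 hb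
    exact (hn a ha).trans (hφ a)

/-- Replacing an element by a larger one. -/
theorem insert_mem_fine_of_le (hβ : IsEpsilonSeq β) {α : Ordinal.{0}} (hα : α < ω₁)
    {A : Finset ℕ+} {k n : ℕ+} (hkn : k ≤ n) (hk : k ∉ A) (h : insert k A ∈ fine β α) :
    insert n A ∈ fine β α := by
  have h1 := image_mem_fine hβ hα (Function.update id k n) (fun a => by
    by_cases h : a = k
    · subst h; simpa using hkn
    · simp [h]) _ h
  convert h1 using 1
  rw [Finset.image_insert, Function.update_self]
  congr 1
  refine (Finset.image_id.symm.trans (Finset.image_congr fun a ha => ?_))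
  have : a ≠ k := fun h => hk (h ▸ ha)
  simp [this]

/-- The point `n` adjoined in the definition need not be the minimum. If it is not, spreading moves
`a` up to `n` inside the remaining set, which then contains everything but `a`. -/
theorem erase_min_mem_fine (hβ : IsEpsilonSeq β) {α : Ordinal.{0}} (hα : α + 1 < ω₁)
    {A : Finset ℕ+} (hA : A ∈ fine β (α + 1)) {a : ℕ+} (ha : a ∈ A) (hmin : ∀ b ∈ A, a ≤ b) :
    A.erase a ∈ fine β α := by
  have hα' : α < ω₁ := (lt_add_one α).trans hα
  rw [fine_add_one] at hA
  rcases hA with ⟨n, A, hA, rfl⟩ | rfl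
  · by_cases han : a = n
    · subst han
      refine fine_hereditary hβ hα' A hA _ fun x hx => ?_
      simp only [Finset.mem_erase, Finset.mem_insert] at hx
      tauto
    · have haA : a ∈ A := by simpa [han] using ha
      have han' : a ≤ n := hmin n (Finset.mem_insert_self _ _)
      have h1 := insert_mem_fine_of_le hβ hα' (A := A.erase a) han' (by simp)
        (by rwa [Finset.insert_erase haA])
      refine fine_hereditary hβ hα' _ h1 _ fun x hx => ?_
      simp only [Finset.mem_erase, Finset.mem_insert] at hx ⊢
      tauto
  · simp at ha

theorem fundSeq_ne_zero {α : Ordinal.{0}} (hα : IsSuccLimit α) (n : ℕ+) :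
    fundSeq β α n ≠ 0 := by
  have h0 (ξ : Ordinal.{0}) : ω ^ ξ ≠ 0 := (opow_pos ξ omega0_pos).ne'
  rcases isSuccLimit_cases hα with ⟨ξ, r, hr, hr1, -, rfl⟩ | ⟨ζ, rfl⟩ | ⟨ξ, hξ, -, rfl⟩
  · rw [fundSeq_add hr1 hr.ne_bot]
    exact ((opow_pos ξ omega0_pos).trans_le le_self_add).ne'
  · rw [fundSeq_opow_add_one]
    exact mul_ne_zero (h0 ζ) (by simp)
  · rw [fundSeq_opow hξ]
    exact h0 _

theorem singleton_mem_fine (hβ : IsEpsilonSeq β) {α : Ordinal.{0}} (hα : α < ω₁) (h0 : α ≠ 0)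
    (k : ℕ+) : {k} ∈ fine β α := by
  induction α, hα using countable_induction with
  | zero => exact absurd rfl h0
  | add_one α h ih =>
    exact insert_mem_fine_add_one (empty_mem_fine hβ ((lt_add_one α).trans h)) k
  | limit α h1 h ih =>
    exact (mem_fine_limit hβ h1 h).2
      ⟨1, by simp, ih _ (fundSeq_lt hβ h1 h 1) (fundSeq_ne_zero h 1)⟩

/-- If a set has an end-extension by one element in `fine β α`, then all its end-extensions by one
element are in `fine β α`. -/
theorem insert_mem_fine_of_lt (hβ : IsEpsilonSeq β) {α : Ordinal.{0}} (hα : α < ω₁)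
    {A : Finset ℕ+} {k n : ℕ+} (hk : ∀ a ∈ A, a < k) (hn : ∀ a ∈ A, a < n)
    (h : insert k A ∈ fine β α) : insert n A ∈ fine β α := by
  induction α, hα using countable_induction generalizing A with
  | zero => simp [fine_zero] at h
  | add_one α h1 ih =>
    rcases A.eq_empty_or_nonempty with rfl | hA
    · exact singleton_mem_fine hβ h1 (by simp) n
    have hm := A.min'_mem hA
    set m := A.min' hA
    have h2 := erase_min_mem_fine hβ h1 h (Finset.mem_insert_of_mem hm) (by
      intro b hb
      rcases Finset.mem_insert.1 hb with rfl | hb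
      · exact (hk m hm).le
      · exact A.min'_le b hb)
    rw [Finset.erase_insert_of_ne (hk m hm).ne'] at h2
    have h3 := insert_mem_fine_add_one (ih (fun a ha => hk a (Finset.mem_of_mem_erase ha))
      (fun a ha => hn a (Finset.mem_of_mem_erase ha)) h2) m
    rwa [Finset.insert_comm, Finset.insert_erase hm] at h3
  | limit α h1 h2 ih =>
    rcases A.eq_empty_or_nonempty with rfl | ⟨b, hb⟩
    · exact singleton_mem_fine hβ h1 h2.ne_bot n
    obtain ⟨m, hm, hA⟩ := (mem_fine_limit hβ h1 h2).1 h
    refine (mem_fine_limit hβ h1 h2).2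
      ⟨m, fun a ha => ?_, ih _ (fundSeq_lt hβ h1 h2 m) hk hn hA⟩
    rcases Finset.mem_insert.1 ha with rfl | ha
    · exact (hm b (Finset.mem_insert_of_mem hb)).trans (hn b hb).le
    · exact hm a (Finset.mem_insert_of_mem ha)

/-- A non-maximal set can be extended by any larger element. -/
theorem insert_mem_fine_of_notMem_maxFam (hβ : IsEpsilonSeq β) {α : Ordinal.{0}} (hα : α < ω₁)
    {A : Finset ℕ+} (hA : A ∈ fine β α) (hmax : A ∉ maxFam (fine β α)) {n : ℕ+}
    (hn : ∀ a ∈ A, a < n) : insert n A ∈ fine β α := by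
  have h1 : ∃ B ∈ fine β α, A ⊂ B := by
    by_contra! h
    exact hmax ⟨hA, fun B hB hAB => by
      by_contra hBA
      exact h B hB ⟨hAB, hBA⟩⟩
  obtain ⟨B, hB, hAB⟩ := h1
  obtain ⟨k, hkB, hkA⟩ := Finset.exists_of_ssubset hAB
  have h2 : insert k A ∈ fine β α :=
    fine_hereditary hβ hα B hB _ (Finset.insert_subset hkB hAB.1)
  by_cases hkn : k ≤ n
  · exact insert_mem_fine_of_le hβ hα hkn hkA h2
  · exact insert_mem_fine_of_lt hβ hα (fun a ha => (hn a ha).trans (not_le.1 hkn)) hn h2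

theorem insert_notMem_of_mem_maxFam {F : Set (Finset ℕ+)} {A : Finset ℕ+} (hA : A ∈ maxFam F)
    {n : ℕ+} (hn : n ∉ A) : insert n A ∉ F := fun h =>
  hn (hA.2 h (Finset.subset_insert n A) (Finset.mem_insert_self n A))

theorem exists_forall_lt (A : Finset ℕ+) : ∃ n : ℕ+, ∀ a ∈ A, a < n := by
  obtain ⟨m, hm⟩ := A.bddAbove
  exact ⟨m + 1, fun a ha => PNat.lt_add_one_iff.2 (hm ha)⟩

theorem nonempty_of_mem_maxFam_fine (hβ : IsEpsilonSeq β) {α : Ordinal.{0}} (hα : α < ω₁)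
    (h0 : α ≠ 0) {A : Finset ℕ+} (hA : A ∈ maxFam (fine β α)) : A.Nonempty := by
  rw [Finset.nonempty_iff_ne_empty]
  rintro rfl
  exact insert_notMem_of_mem_maxFam hA (n := 1) (by simp)
    (by simpa using singleton_mem_fine hβ hα h0 1)

/-- `fine β ζ` is eventually contained in `fine β α` if `ζ ≤ α`. -/
theorem exists_fine_subset (hβ : IsEpsilonSeq β) {α : Ordinal.{0}} (hα : α < ω₁) :
    ∀ ζ ≤ α, ∃ N : ℕ+, ∀ A ∈ fine β ζ, (∀ a ∈ A, N ≤ a) → A ∈ fine β α := by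
  induction α, hα using countable_induction with
  | zero =>
    intro ζ hζ
    obtain rfl : ζ = 0 := by simpa using hζ
    exact ⟨1, fun A hA _ => hA⟩
  | add_one α h ih =>
    intro ζ hζ
    rcases hζ.eq_or_lt with rfl | hζ
    · exact ⟨1, fun A hA _ => hA⟩
    · obtain ⟨N, hN⟩ := ih ζ (lt_add_one_iff.1 hζ)
      exact ⟨N, fun A hA h1 => fine_subset_add_one hβ ((lt_add_one α).trans h) (hN A hA h1)⟩
  | limit α h1 h ih =>
    intro ζ hζ
    rcases hζ.eq_or_lt with rfl | hζ
    · exact ⟨1, fun A hA _ => hA⟩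
    · obtain ⟨n, hn⟩ := exists_lt_fundSeq hβ h1 h hζ
      obtain ⟨N, hN⟩ := ih _ (fundSeq_lt hβ h1 h n) ζ hn.le
      refine ⟨max N n, fun A hA h2 => (mem_fine_limit hβ h1 h).2 ⟨n, fun a ha => ?_, ?_⟩⟩
      · exact (le_max_right _ _).trans (h2 a ha)
      · exact hN A hA fun a ha => (le_max_left _ _).trans (h2 a ha)

/-- If `ζ < α`, sets in `fine β ζ` with large minimum are not maximal in `fine β α`. -/
theorem exists_notMem_maxFam (hβ : IsEpsilonSeq β) {α ζ : Ordinal.{0}} (hα : α < ω₁)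
    (hζ : ζ < α) :
    ∃ N : ℕ+, ∀ A ∈ fine β ζ, (∀ a ∈ A, N < a) → A ∉ maxFam (fine β α) := by
  obtain ⟨N, hN⟩ := exists_fine_subset hβ hα (ζ + 1) (add_one_le_of_lt hζ)
  refine ⟨N, fun A hA h hmax => ?_⟩
  -- The order `ζ + 1 ≤ α` leaves room for one more point, and `N` itself is large enough to be that
  -- point.
  refine insert_notMem_of_mem_maxFam hmax (fun h1 => (h N h1).false)
    (hN _ (insert_mem_fine_add_one hA N) fun a ha => ?_)
  rcases Finset.mem_insert.1 ha with rfl | ha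
  · exact le_rfl
  · exact (h a ha).le

/-- Sets in `fine β (ω ^ ξ + r)` are a set in `fine β r` followed by a set in `fine β (ω ^ ξ)`. -/
theorem mem_fine_opow_add (hβ : IsEpsilonSeq β) {ξ : Ordinal.{0}} (hξ : ξ < ω₁) {r : Ordinal.{0}}
    (hr1 : r < ω₁) (hr : r < ω ^ (ξ + 1)) {A : Finset ℕ+} :
    A ∈ fine β (ω ^ ξ + r) ↔ ∃ A₁ ∈ fine β r, ∃ A₂ ∈ fine β (ω ^ ξ),
      (∀ a ∈ A₁, ∀ b ∈ A₂, a < b) ∧ A = A₁ ∪ A₂ := by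
  have hadd {s : Ordinal.{0}} (hs : s < ω₁) : ω ^ ξ + s < ω₁ :=
    isPrincipal_add_omega 1 (opow_lt_omega_one hξ) hs
  induction r, hr1 using countable_induction generalizing A with
  | zero => simp [fine_zero]
  | add_one r h1 ih =>
    have hr' : r < ω₁ := (lt_add_one r).trans h1
    have ih {A : Finset ℕ+} := @ih ((lt_add_one r).trans hr) A
    rw [← add_assoc]
    constructor
    · intro hA
      rcases A.eq_empty_or_nonempty with rfl | hne
      · exact ⟨∅, empty_mem_fine hβ h1, ∅, empty_mem_fine hβ (opow_lt_omega_one hξ),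
          by simp, by simp⟩
      have hm := A.min'_mem hne
      have hlt : ∀ b ∈ A.erase (A.min' hne), A.min' hne < b := fun b hb =>
        A.min'_lt_of_mem_erase_min' hne hb
      obtain ⟨A₁, hA₁, A₂, hA₂, h12, h⟩ := ih.1 (erase_min_mem_fine hβ
        (by rw [add_assoc]; exact hadd h1) hA hm (fun b hb => A.min'_le b hb))
      rw [h] at hlt
      refine ⟨insert (A.min' hne) A₁, insert_mem_fine_add_one hA₁ _, A₂, hA₂, ?_, ?_⟩
      · intro a ha b hb
        rcases Finset.mem_insert.1 ha with rfl | ha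
        · exact hlt b (Finset.mem_union_right _ hb)
        · exact h12 a ha b hb
      · rw [Finset.insert_union, ← h, Finset.insert_erase hm]
    · rintro ⟨A₁, hA₁, A₂, hA₂, h12, rfl⟩
      rw [fine_add_one] at hA₁
      rcases hA₁ with ⟨n, A₁, hA₁, rfl⟩ | rfl
      · rw [Finset.insert_union]
        exact insert_mem_fine_add_one (ih.2 ⟨A₁, hA₁, A₂, hA₂,
          fun a ha => h12 a (Finset.mem_insert_of_mem ha), rfl⟩) _
      · exact fine_subset_add_one hβ (hadd hr')
          (ih.2 ⟨∅, empty_mem_fine hβ hr', A₂, hA₂, by simp, rfl⟩)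
  | limit r h1 h ih =>
    have hlim : IsSuccLimit (ω ^ ξ + r) := isSuccLimit_add _ h
    rw [mem_fine_limit hβ (hadd h1) hlim]
    simp only [fundSeq_add hr h.ne_bot]
    have ih (n : ℕ+) {A : Finset ℕ+} := @ih _ (fundSeq_lt hβ h1 h n)
      ((fundSeq_lt hβ h1 h n).trans hr) A
    constructor
    · rintro ⟨n, hn, hA⟩
      obtain ⟨A₁, hA₁, A₂, hA₂, h12, rfl⟩ := (ih n).1 hA
      exact ⟨A₁, (mem_fine_limit hβ h1 h).2
        ⟨n, fun a ha => hn a (Finset.mem_union_left _ ha), hA₁⟩, A₂, hA₂, h12, rfl⟩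
    · rintro ⟨A₁, hA₁, A₂, hA₂, h12, rfl⟩
      rcases A₁.eq_empty_or_nonempty with rfl | ⟨a, ha⟩
      · exact ⟨1, by simp, (ih 1).2 ⟨∅, empty_mem_fine hβ ((fundSeq_lt hβ h1 h 1).trans h1),
          A₂, hA₂, by simp, rfl⟩⟩
      · obtain ⟨n, hn, hA₁⟩ := (mem_fine_limit hβ h1 h).1 hA₁
        refine ⟨n, fun b hb => ?_, (ih n).2 ⟨A₁, hA₁, A₂, hA₂, h12, rfl⟩⟩
        rcases Finset.mem_union.1 hb with hb | hb
        · exact hn b hb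
        · exact (hn a ha).trans (h12 a ha b hb).le

/-! ### Multiples of `ω ^ ξ` and block decompositions of maximal Schreier sets -/

theorem opow_mul_natCast_lt (ξ : Ordinal.{0}) (n : ℕ) :
    ω ^ ξ * (n : Ordinal) < ω ^ (ξ + 1) := by
  rw [opow_add_one]
  exact mul_lt_mul_of_pos_left (natCast_lt_omega0 _) (opow_pos _ omega0_pos)

theorem opow_mul_natCast_lt_omega_one {ξ : Ordinal.{0}} (hξ : ξ < ω₁) (n : ℕ) :
    ω ^ ξ * (n : Ordinal) < ω₁ :=
  (opow_mul_natCast_lt ξ n).trans (opow_lt_omega_one (add_one_lt_omega_one hξ))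

theorem mem_fine_opow_mul_add_one (hβ : IsEpsilonSeq β) {ξ : Ordinal.{0}} (hξ : ξ < ω₁) (n : ℕ)
    {A : Finset ℕ+} : A ∈ fine β (ω ^ ξ * ((n + 1 : ℕ) : Ordinal)) ↔
      ∃ A₁ ∈ fine β (ω ^ ξ * (n : Ordinal)), ∃ A₂ ∈ schreier β ξ,
        (∀ a ∈ A₁, ∀ b ∈ A₂, a < b) ∧ A = A₁ ∪ A₂ := by
  -- Written as `ω ^ ξ + ω ^ ξ * n`, the ordinal has its leading term split off, and this term
  -- governs the last block.
  rw [Nat.cast_succ, Nat.cast_add_one_comm, mul_one_add]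
  exact mem_fine_opow_add hβ hξ (opow_mul_natCast_lt_omega_one hξ n) (opow_mul_natCast_lt ξ n)

theorem schreier_zero : schreier β 0 = {B | ∃ n : ℕ+, B = {n}} ∪ {∅} := by
  rw [schreier, opow_zero, ← zero_add 1, fine_add_one, fine_zero]
  simp

theorem mem_schreier_limit (hβ : IsEpsilonSeq β) {α : Ordinal.{0}} (h1 : α < ω₁)
    (hα : IsSuccLimit α) {A : Finset ℕ+} :
    A ∈ schreier β α ↔ ∃ n : ℕ+, (∀ a ∈ A, n ≤ a) ∧ A ∈ schreier β (schreierSeq β α n) := by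
  rw [schreier, mem_fine_limit hβ (opow_lt_omega_one h1)
    (isSuccLimit_opow one_lt_omega0 hα)]
  simp only [fundSeq_opow hα, schreier]

theorem mem_schreier_add_one (hβ : IsEpsilonSeq β) {α : Ordinal.{0}} (h1 : α + 1 < ω₁)
    {A : Finset ℕ+} : A ∈ schreier β (α + 1) ↔
      ∃ n : ℕ+, (∀ a ∈ A, n ≤ a) ∧ A ∈ fine β (ω ^ α * ((n : ℕ) : Ordinal)) := by
  rw [schreier, mem_fine_limit hβ (opow_lt_omega_one h1) (isSuccLimit_omega0_opow (by simp))]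
  simp only [fundSeq_opow_add_one]

theorem nonempty_of_mem_maxFam_schreier (hβ : IsEpsilonSeq β) {α : Ordinal.{0}} (hα : α < ω₁)
    {A : Finset ℕ+} (hA : A ∈ maxFam (schreier β α)) : A.Nonempty :=
  nonempty_of_mem_maxFam_fine hβ (opow_lt_omega_one hα) (opow_pos _ omega0_pos).ne' hA

theorem schreier_hereditary (hβ : IsEpsilonSeq β) {α : Ordinal.{0}} (hα : α < ω₁) :
    ∀ A ∈ schreier β α, ∀ B ⊆ A, B ∈ schreier β α :=
  fine_hereditary hβ (opow_lt_omega_one hα)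

/-- A maximal set in `fine β (ω ^ ξ * (n + 1))` is a maximal set in `fine β (ω ^ ξ * n)` followed
by a maximal set in `schreier β ξ`. -/
theorem exists_maxFam_union (hβ : IsEpsilonSeq β) {ξ : Ordinal.{0}} (hξ : ξ < ω₁) (n : ℕ)
    {A : Finset ℕ+} (hA : A ∈ maxFam (fine β (ω ^ ξ * ((n + 1 : ℕ) : Ordinal)))) :
    ∃ A₁ ∈ maxFam (fine β (ω ^ ξ * (n : Ordinal))), ∃ A₂ ∈ maxFam (schreier β ξ),
      (∀ a ∈ A₁, ∀ b ∈ A₂, a < b) ∧ A = A₁ ∪ A₂ := by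
  classical
  have hn := opow_mul_natCast_lt_omega_one hξ n
  have key {B : Finset ℕ+} := mem_fine_opow_mul_add_one hβ hξ n (A := B)
  have hξ' := opow_lt_omega_one hξ
  let P : Finset ℕ+ → Prop := fun A₁ => A₁ ∈ fine β (ω ^ ξ * (n : Ordinal)) ∧
    ∃ A₂ ∈ schreier β ξ, (∀ a ∈ A₁, ∀ b ∈ A₂, a < b) ∧ A = A₁ ∪ A₂
  obtain ⟨B, hB, B', hB'⟩ := key.1 hA.1
  have hne : (A.powerset.filter P).Nonempty :=
    ⟨B, Finset.mem_filter.2 ⟨by rw [Finset.mem_powerset, hB'.2.2]; exact Finset.subset_union_left, hB, B', hB'⟩⟩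
  -- Take the longest possible first part. Were it not maximal, it could absorb the minimum of `A₂`;
  -- were `A₂` not maximal, `A` could be extended beyond its maximum.
  obtain ⟨A₁, hA₁, hmax⟩ := Finset.exists_max_image _ Finset.card hne
  obtain ⟨-, hA₁, A₂, hA₂, h12, hA12⟩ := Finset.mem_filter.1 hA₁
  obtain ⟨k, hk⟩ := exists_forall_lt A
  have hkA : k ∉ A := fun h => (hk k h).false
  have hnot := insert_notMem_of_mem_maxFam hA hkA
  rw [hA12] at hk hnot
  have hne2 : A₂.Nonempty := by
    rw [Finset.nonempty_iff_ne_empty]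
    rintro rfl
    refine hnot (key.2 ⟨A₁, hA₁, {k}, singleton_mem_fine hβ hξ' (opow_pos _ omega0_pos).ne' k,
      fun a ha b hb => ?_, ?_⟩)
    · rw [Finset.mem_singleton.1 hb]
      exact hk a (Finset.mem_union_left _ ha)
    · simp
  refine ⟨A₁, ?_, A₂, ?_, h12, hA12⟩
  · by_contra h
    have hm := A₂.min'_mem hne2
    set m := A₂.min' hne2 with hmdef
    have hmA : m ∉ A₁ := fun h => (h12 m h m hm).false
    have h1 := insert_mem_fine_of_notMem_maxFam hβ hn hA₁ h (fun a ha => h12 a ha m hm)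
    have h2 := hmax (insert m A₁) (Finset.mem_filter.2 ⟨?_, h1, A₂.erase m,
      schreier_hereditary hβ hξ A₂ hA₂ _ (Finset.erase_subset _ _), ?_, ?_⟩)
    · rw [Finset.card_insert_of_notMem hmA] at h2
      omega
    · rw [Finset.mem_powerset, hA12]
      exact Finset.insert_subset (Finset.mem_union_right _ hm) Finset.subset_union_left
    · intro a ha c hc
      rcases Finset.mem_insert.1 ha with rfl | ha
      · exact A₂.min'_lt_of_mem_erase_min' hne2 hc
      · exact h12 a ha c (Finset.mem_of_mem_erase hc)
    · rw [hA12, Finset.insert_union, ← Finset.union_insert, Finset.insert_erase hm]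
  · by_contra h
    refine hnot (key.2 ⟨A₁, hA₁, insert k A₂, insert_mem_fine_of_notMem_maxFam hβ hξ' hA₂ h
      fun a ha => hk a (Finset.mem_union_right _ ha), fun a ha c hc => ?_, ?_⟩)
    · rcases Finset.mem_insert.1 hc with rfl | hc
      · exact hk a (Finset.mem_union_left _ ha)
      · exact h12 a ha c hc
    · rw [Finset.union_insert]

theorem exists_blocks (hβ : IsEpsilonSeq β) {ξ : Ordinal.{0}} (hξ : ξ < ω₁) (n : ℕ)
    {A : Finset ℕ+} (hA : A ∈ maxFam (fine β (ω ^ ξ * (n : Ordinal)))) :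
    ∃ E : Fin n → Finset ℕ+, (∀ j, E j ∈ maxFam (schreier β ξ)) ∧
      (∀ i j, i < j → ∀ a ∈ E i, ∀ b ∈ E j, a < b) ∧ Finset.univ.biUnion E = A := by
  induction n generalizing A with
  | zero =>
    refine ⟨Fin.elim0, fun j => j.elim0, fun j => j.elim0, ?_⟩
    have h : A ∈ fine β (ω ^ ξ * ((0 : ℕ) : Ordinal)) := hA.1
    rw [Nat.cast_zero, mul_zero, fine_zero] at h
    rw [Set.mem_singleton_iff.1 h]
    rfl
  | succ n ih =>
    obtain ⟨A₁, hA₁, A₂, hA₂, h12, rfl⟩ := exists_maxFam_union hβ hξ n hA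
    obtain ⟨E, hE, hlt, rfl⟩ := ih hA₁
    refine ⟨Fin.snoc E A₂, fun j => ?_, fun i j hij => ?_, ?_⟩
    · refine Fin.lastCases ?_ (fun j => ?_) j
      · simpa using hA₂
      · simpa using hE j
    · induction j using Fin.lastCases with
      | last =>
        induction i using Fin.lastCases with
        | last => exact absurd hij (lt_irrefl _)
        | cast i =>
          intro a ha b hb
          simp only [Fin.snoc_castSucc, Fin.snoc_last] at ha hb
          exact h12 a (Finset.mem_biUnion.2 ⟨i, Finset.mem_univ _, ha⟩) b hb
      | cast j =>
        induction i using Fin.lastCases with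
        | last => exact absurd (hij.trans (Fin.castSucc_lt_last j)) (lt_irrefl _)
        | cast i =>
          simp only [Fin.snoc_castSucc]
          exact hlt i j (by simpa using hij)
    · ext a
      simp only [Finset.mem_biUnion, Finset.mem_univ, true_and, Finset.mem_union]
      constructor
      · rintro ⟨j, hj⟩
        induction j using Fin.lastCases with
        | last => exact Or.inr (by simpa using hj)
        | cast j => exact Or.inl ⟨j, by simpa using hj⟩
      · rintro (⟨j, hj⟩ | h)
        · exact ⟨j.castSucc, by simpa using hj⟩
        · exact ⟨Fin.last n, by simpa using h⟩

theorem exists_isBlockDecomp (hβ : IsEpsilonSeq β) {α : Ordinal.{0}} (hα : α + 1 < ω₁)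
    {A : Finset ℕ+} (hA : A ∈ maxFam (schreier β (α + 1))) :
    ∃ (n : ℕ+) (E : Fin (n : ℕ) → Finset ℕ+), IsBlockDecomp (schreier β α) A n E := by
  have hα' : α < ω₁ := (lt_add_one α).trans hα
  have hne := nonempty_of_mem_maxFam_schreier hβ hα hA
  obtain ⟨k, hk⟩ := exists_forall_lt A
  have hkA : k ∉ A := fun h => (hk k h).false
  have hnot := insert_notMem_of_mem_maxFam hA hkA
  obtain ⟨n, hn, hAn⟩ := (mem_schreier_add_one hβ hα).1 hA.1
  have hm := A.min'_mem hne
  set m := A.min' hne with hmdef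
  have hins (l : ℕ+) (hl : l ≤ m) : ∀ a ∈ insert k A, l ≤ a := by
    intro a ha
    rcases Finset.mem_insert.1 ha with rfl | ha
    · exact hl.trans (hk m hm).le
    · exact hl.trans (A.min'_le a ha)
  -- With `n < min A`, the index `n + 1` would still be admissible and leave room for the extra
  -- block `{k}`.
  have hnm : n = m := by
    by_contra h
    have hlt : n < m := lt_of_le_of_ne (hn m hm) h
    refine hnot ((mem_schreier_add_one hβ hα).2
      ⟨n + 1, hins _ (PNat.add_one_le_iff.2 hlt), ?_⟩)
    rw [PNat.add_coe, PNat.one_coe]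
    refine (mem_fine_opow_mul_add_one hβ hα' n).2 ⟨A, hAn, {k},
      singleton_mem_fine hβ (opow_lt_omega_one hα') (opow_pos _ omega0_pos).ne' k, ?_, ?_⟩
    · simpa using hk
    · simp
  have hmax : A ∈ maxFam (fine β (ω ^ α * ((n : ℕ) : Ordinal))) := by
    by_contra h
    exact hnot ((mem_schreier_add_one hβ hα).2 ⟨n, hins n hnm.le,
      insert_mem_fine_of_notMem_maxFam hβ (opow_mul_natCast_lt_omega_one hα' n) hAn h hk⟩)
  obtain ⟨E, hE, hlt, hU⟩ := exists_blocks hβ hα' n hmax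
  exact ⟨n, E, ⟨by rw [hnm]; exact hm, fun a ha => hn a ha⟩, hE, hlt, hU⟩

/-- Adding a point beyond `max A` keeps `n` below the minimum, so an extension at order `μ(α, n)`
would also be one at order `α`. -/
theorem maxFam_schreier_limit (hβ : IsEpsilonSeq β) {α : Ordinal.{0}} (h1 : α < ω₁)
    (hα : IsSuccLimit α) {A : Finset ℕ+} (hA : A ∈ maxFam (schreier β α)) {n : ℕ+}
    (hn : ∀ a ∈ A, n ≤ a) (h : A ∈ schreier β (schreierSeq β α n)) :
    A ∈ maxFam (schreier β (schreierSeq β α n)) := by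
  by_contra hmax
  obtain ⟨a, ha⟩ := nonempty_of_mem_maxFam_schreier hβ h1 hA
  obtain ⟨k, hk⟩ := exists_forall_lt A
  refine insert_notMem_of_mem_maxFam hA (fun h => (hk k h).false)
    ((mem_schreier_limit hβ h1 hα).2 ⟨n, fun b hb => ?_, insert_mem_fine_of_notMem_maxFam hβ
      (opow_lt_omega_one ((schreierSeq_lt hβ h1 hα n).trans h1)) h hmax hk⟩)
  rcases Finset.mem_insert.1 hb with rfl | hb
  · exact (hn a ha).trans (hk a ha).le
  · exact hn b hb

/-! ### Existence of maximal sets -/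

/-- At a limit, membership of a nonempty initial segment can only be witnessed by some `n ≤ s 0`;
these finitely many families are all left after a common length. -/
theorem exists_notMem_fine (hβ : IsEpsilonSeq β) {α : Ordinal.{0}} (hα : α < ω₁) (s : ℕ → ℕ+)
    (hs : StrictMono s) : ∃ i, (Finset.range i).image s ∉ fine β α := by
  induction α, hα using countable_induction generalizing s with
  | zero => exact ⟨1, by simp [fine_zero]⟩
  | add_one α h ih =>
    obtain ⟨i, hi⟩ := ih (fun i => s (i + 1)) fun i j hij => hs (by omega)
    refine ⟨i + 1, fun hmem => hi ?_⟩
    have h1 := erase_min_mem_fine hβ h hmem (a := s 0)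
      (Finset.mem_image_of_mem s (by simp)) (by
        intro b hb
        obtain ⟨j, -, rfl⟩ := Finset.mem_image.1 hb
        exact hs.monotone (Nat.zero_le j))
    refine fine_hereditary hβ ((lt_add_one α).trans h) _ h1 _ fun b hb => ?_
    obtain ⟨j, hj, rfl⟩ := Finset.mem_image.1 hb
    rw [Finset.mem_erase]
    exact ⟨(hs (Nat.succ_pos j)).ne', Finset.mem_image_of_mem s (by simpa using hj)⟩
  | limit α h1 h ih =>
    choose i hi using fun n : ℕ+ => ih _ (fundSeq_lt hβ h1 h n) s hs
    obtain ⟨I, hI⟩ := ((Finset.Icc 1 (s 0)).image i).bddAbove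
    refine ⟨I + 1, fun hmem => ?_⟩
    obtain ⟨n, hn, hmem⟩ := (mem_fine_limit hβ h1 h).1 hmem
    have h0 : n ≤ s 0 := hn _ (Finset.mem_image_of_mem s (by simp))
    have hle : i n ≤ I := hI (Finset.mem_coe.2 (Finset.mem_image_of_mem i (by simp [h0])))
    exact hi n (fine_hereditary hβ ((fundSeq_lt hβ h1 h n).trans h1) _ hmem _
      (Finset.image_subset_image (Finset.range_mono (by omega))))

/-- The longest initial segment of a sequence in `N` that is a Schreier set works: being extendable
by no later term of the sequence, it is maximal in the whole family, not only among subsets of `N`.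
-/
theorem exists_mem_maxFam_schreier (hβ : IsEpsilonSeq β) {α : Ordinal.{0}} (hα : α < ω₁)
    {N : Set ℕ+} (hN : N.Infinite) :
    ∃ B ∈ maxFam (schreier β α), (B : Set ℕ+) ⊆ N := by
  classical
  have hα' := opow_lt_omega_one hα
  obtain ⟨φ, hφ, hφN⟩ := Filter.extraction_of_frequently_atTop (P := fun n => n.succPNat ∈ N)
    (Filter.frequently_atTop.2 fun m => by
      obtain ⟨n, hn, hmn⟩ := hN.exists_gt m.succPNat
      refine ⟨n.natPred, ?_, by simpa using hn⟩
      have : m.succPNat.natPred < n.natPred := PNat.natPred_lt_natPred.2 hmn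
      exact le_of_lt (by simpa using this))
  let s : ℕ → ℕ+ := fun i => (φ i).succPNat
  have hs : StrictMono s := Nat.succPNat_strictMono.comp hφ
  have hex := exists_notMem_fine hβ hα' s hs
  have hspec := Nat.find_spec hex
  obtain ⟨k, hk⟩ : ∃ k, Nat.find hex = k + 1 := by
    refine Nat.exists_eq_succ_of_ne_zero fun h => ?_
    rw [h] at hspec
    exact hspec (by simpa using empty_mem_fine hβ hα')
  have hmem : (Finset.range k).image s ∈ fine β (ω ^ α) := by
    by_contra h
    exact Nat.find_min hex (by omega) h
  rw [hk, Finset.range_add_one, Finset.image_insert] at hspec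
  refine ⟨(Finset.range k).image s, ?_, ?_⟩
  · by_contra h
    refine hspec (insert_mem_fine_of_notMem_maxFam hβ hα' hmem h fun a ha => ?_)
    obtain ⟨i, hi, rfl⟩ := Finset.mem_image.1 ha
    exact hs (Finset.mem_range.1 hi)
  · intro a ha
    obtain ⟨i, -, rfl⟩ := Finset.mem_image.1 (Finset.mem_coe.1 ha)
    exact hφN i

/-! ### The repeated averages -/

theorem weight_eq_zero (α : Ordinal.{0}) {A : Finset ℕ+} {a : ℕ+} (ha : a ∉ A) :
    weight β α A a = 0 := by
  classical
  induction α using limitRecOn generalizing A with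
  | zero => simp [weight, ha]
  | add_one α ih =>
    rw [weight, limitRecOn_add_one]
    split_ifs with h
    · rw [Finset.sum_eq_zero, mul_zero]
      intro j _
      refine ih fun h' => ha ?_
      rw [← h.choose_spec.choose_spec.union_eq]
      exact Finset.mem_biUnion.2 ⟨j, Finset.mem_univ _, h'⟩
    · rfl
  | limit α hα ih =>
    rw [weight, limitRecOn_limit _ _ _ _ hα]
    split_ifs with h
    · exact ih _ (PNat.find_spec h).1 ha
    · rfl

theorem weight_nonneg (α : Ordinal.{0}) (A : Finset ℕ+) (a : ℕ+) : 0 ≤ weight β α A a := by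
  classical
  induction α using limitRecOn generalizing A with
  | zero =>
    simp only [weight, limitRecOn_zero]
    split_ifs <;> norm_num
  | add_one α ih =>
    rw [weight, limitRecOn_add_one]
    split_ifs with h
    · exact mul_nonneg (by positivity) (Finset.sum_nonneg fun j _ => ih _)
    · exact le_rfl
  | limit α hα ih =>
    rw [weight, limitRecOn_limit _ _ _ _ hα]
    split_ifs with h
    · exact ih _ (PNat.find_spec h).1 _
    · exact le_rfl

/-- The mass of a set with respect to `P_{(α, B)}`. -/
noncomputable def mass (β : Ordinal.{0} → ℕ+ → Ordinal.{0}) (α : Ordinal.{0})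
    (B A : Finset ℕ+) : ℝ :=
  ∑ a ∈ A, weight β α B a

theorem mass_nonneg (α : Ordinal.{0}) (B A : Finset ℕ+) : 0 ≤ mass β α B A :=
  Finset.sum_nonneg fun _ _ => weight_nonneg _ _ _

theorem mass_inter (α : Ordinal.{0}) (B A : Finset ℕ+) :
    mass β α B (A ∩ B) = mass β α B A :=
  Finset.sum_subset Finset.inter_subset_left fun _ h1 h =>
    weight_eq_zero α fun h2 => h (Finset.mem_inter.2 ⟨h1, h2⟩)

/-- The decomposition chosen in `weight` serves as the witness, so its uniqueness is never needed.
-/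
theorem exists_mass_add_one (hβ : IsEpsilonSeq β) {α : Ordinal.{0}} (hα : α + 1 < ω₁)
    {B : Finset ℕ+} (hB : B ∈ maxFam (schreier β (α + 1))) :
    ∃ (n : ℕ+) (E : Fin (n : ℕ) → Finset ℕ+), IsBlockDecomp (schreier β α) B n E ∧
      ∀ A, mass β (α + 1) B A = 1 / ((n : ℕ) : ℝ) * ∑ j, mass β α (E j) A := by
  have h := exists_isBlockDecomp hβ hα hB
  refine ⟨h.choose, h.choose_spec.choose, h.choose_spec.choose_spec, fun A => ?_⟩
  simp only [mass]
  rw [Finset.sum_comm, Finset.mul_sum]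
  refine Finset.sum_congr rfl fun a _ => ?_
  rw [weight, limitRecOn_add_one, dif_pos h]
  rfl

theorem exists_mass_limit (hβ : IsEpsilonSeq β) {α : Ordinal.{0}} (h1 : α < ω₁)
    (hα : IsSuccLimit α) {B : Finset ℕ+} (hB : B ∈ maxFam (schreier β α)) :
    ∃ n : ℕ+, (∀ b ∈ B, n ≤ b) ∧ B ∈ maxFam (schreier β (schreierSeq β α n)) ∧
      ∀ A, mass β α B A = mass β (schreierSeq β α n) B A := by
  classical
  have h : ∃ n : ℕ+, schreierSeq β α n < α ∧ (∀ b ∈ B, n ≤ b) ∧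
      B ∈ schreier β (schreierSeq β α n) := by
    obtain ⟨n, hn, h⟩ := (mem_schreier_limit hβ h1 hα).1 hB.1
    exact ⟨n, schreierSeq_lt hβ h1 hα n, hn, h⟩
  have hspec := PNat.find_spec h
  refine ⟨PNat.find h, hspec.2.1, maxFam_schreier_limit hβ h1 hα hB hspec.2.1 hspec.2.2,
    fun A => Finset.sum_congr rfl fun a _ => ?_⟩
  rw [weight, limitRecOn_limit _ _ _ _ hα, dif_pos h, weight]

theorem mass_self (hβ : IsEpsilonSeq β) {α : Ordinal.{0}} (hα : α < ω₁) {B : Finset ℕ+}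
    (hB : B ∈ maxFam (schreier β α)) : mass β α B B = 1 := by
  induction α, hα using countable_induction generalizing B with
  | zero =>
    have h : B ∈ schreier β 0 := hB.1
    have hne := nonempty_of_mem_maxFam_schreier hβ (omega_pos 1) hB
    rw [schreier_zero] at h
    rcases h with ⟨n, rfl⟩ | rfl
    · simp [mass, weight]
    · simp at hne
  | add_one α h ih =>
    obtain ⟨n, E, hE, hmass⟩ := exists_mass_add_one hβ h hB
    have h1 (j) : mass β α (E j) B = 1 := by
      have hsub : E j ⊆ B := by
        rw [← hE.union_eq]
        exact Finset.subset_biUnion_of_mem E (Finset.mem_univ j)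
      rw [← mass_inter, Finset.inter_eq_right.2 hsub, ih (hE.mem_max j)]
    simp [hmass, h1]
  | limit α h1 h ih =>
    obtain ⟨n, -, hmax, hmass⟩ := exists_mass_limit hβ h1 h hB
    rw [hmass, ih _ (schreierSeq_lt hβ h1 h n) hmax]

theorem mass_le_one (hβ : IsEpsilonSeq β) {α : Ordinal.{0}} (hα : α < ω₁) {B : Finset ℕ+}
    (hB : B ∈ maxFam (schreier β α)) (A : Finset ℕ+) : mass β α B A ≤ 1 := by
  rw [← mass_self hβ hα hB, ← mass_inter]
  exact Finset.sum_le_sum_of_subset_of_nonneg Finset.inter_subset_right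
    fun _ _ _ => weight_nonneg _ _ _

/-! ### Cantor–Bendixson derivatives -/

/-- Closure of a family of sets under passing to subsets. -/
def Hereditary (F : Set (Finset ℕ+)) : Prop :=
  ∀ A ∈ F, ∀ B ⊆ A, B ∈ F

theorem eventually_forall_lt (A : Finset ℕ+) : ∀ᶠ n in Filter.cofinite, ∀ a ∈ A, a < n := by
  obtain ⟨m, hm⟩ := exists_forall_lt A
  refine (Set.finite_Iic m).subset fun n hn => ?_
  by_contra h
  exact hn fun a ha => (hm a ha).trans (not_le.1 h)

theorem mem_cbDeriv {F : Set (Finset ℕ+)} {A : Finset ℕ+} :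
    A ∈ cbDeriv F ↔ ∃ᶠ n in Filter.cofinite, (∀ a ∈ A, a < n) ∧ insert n A ∈ F :=
  Filter.frequently_cofinite_iff_infinite.symm

theorem cbIter_zero (F : Set (Finset ℕ+)) : cbIter F 0 = F := by
  simp [cbIter]

theorem cbIter_add_one (F : Set (Finset ℕ+)) (γ : Ordinal.{0}) :
    cbIter F (γ + 1) = cbDeriv (cbIter F γ) := by
  simp [cbIter]

theorem mem_cbIter_limit (F : Set (Finset ℕ+)) {γ : Ordinal.{0}} (hγ : IsSuccLimit γ)
    {A : Finset ℕ+} : A ∈ cbIter F γ ↔ ∀ ζ < γ, A ∈ cbIter F ζ := by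
  rw [cbIter, limitRecOn_limit _ _ _ _ hγ]
  rfl

theorem Hereditary.cbDeriv {F : Set (Finset ℕ+)} (hF : Hereditary F) :
    Hereditary (cbDeriv F) := by
  intro A hA B hB
  rw [mem_cbDeriv] at hA ⊢
  exact hA.mono fun n ⟨h1, h2⟩ =>
    ⟨fun b hb => h1 b (hB hb), hF _ h2 _ (Finset.insert_subset_insert n hB)⟩

theorem Hereditary.cbDeriv_subset {F : Set (Finset ℕ+)} (hF : Hereditary F) :
    Schreier.cbDeriv F ⊆ F := by
  intro A hA
  obtain ⟨n, -, h⟩ := (mem_cbDeriv.1 hA).exists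
  exact hF _ h _ (Finset.subset_insert n A)

theorem Hereditary.cbIter {F : Set (Finset ℕ+)} (hF : Hereditary F) (γ : Ordinal.{0}) :
    Hereditary (cbIter F γ) := by
  induction γ using limitRecOn with
  | zero => rwa [cbIter_zero]
  | add_one γ ih => rw [cbIter_add_one]; exact ih.cbDeriv
  | limit γ h ih =>
    intro A hA B hB
    rw [mem_cbIter_limit F h] at hA ⊢
    exact fun ζ hζ => ih ζ hζ A (hA ζ hζ) B hB

theorem Hereditary.cbIter_antitone {F : Set (Finset ℕ+)} (hF : Hereditary F) :
    Antitone (Schreier.cbIter F) := by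
  intro ζ γ h
  induction γ using limitRecOn with
  | zero => rw [show ζ = 0 by simpa using h]
  | add_one γ ih =>
    rcases h.eq_or_lt with rfl | h
    · exact le_rfl
    · rw [cbIter_add_one]
      exact (hF.cbIter γ).cbDeriv_subset.trans (ih (lt_add_one_iff.1 h))
  | limit γ hγ ih =>
    rcases h.eq_or_lt with rfl | h
    · exact le_rfl
    · exact fun A hA => (mem_cbIter_limit F hγ).1 hA ζ h

theorem Hereditary.cbIter_add {F : Set (Finset ℕ+)} (hF : Hereditary F) (γ ζ : Ordinal.{0}) :
    Schreier.cbIter (Schreier.cbIter F γ) ζ = Schreier.cbIter F (γ + ζ) := by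
  induction ζ using limitRecOn with
  | zero => rw [cbIter_zero, add_zero]
  | add_one ζ ih => rw [cbIter_add_one, ih, ← add_assoc, cbIter_add_one]
  | limit ζ h ih =>
    ext A
    rw [mem_cbIter_limit _ h, mem_cbIter_limit _ (isSuccLimit_add γ h)]
    constructor
    · intro hA η hη
      obtain ⟨d, hd, hle⟩ := (lt_add_iff h.ne_bot).1 hη
      have := hA d hd
      rw [ih d hd] at this
      exact hF.cbIter_antitone hle this
    · intro hA d hd
      rw [ih d hd]
      exact hA _ ((add_lt_add_iff_left _).2 hd)

/-- Maps between families which are compatible with end-extensions are compatible with iterated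
derivatives. -/
theorem map_mem_cbIter {F G : Set (Finset ℕ+)} (P : Finset ℕ+ → Prop) (φ : Finset ℕ+ → Finset ℕ+)
    (hP : ∀ C, P C → ∀ n, (∀ c ∈ C, c < n) → P (insert n C) ∧ φ (insert n C) = insert n (φ C))
    (h : ∀ C ∈ F, P C → φ C ∈ G) (γ : Ordinal.{0}) :
    ∀ C ∈ cbIter F γ, P C → φ C ∈ cbIter G γ := by
  induction γ using limitRecOn with
  | zero => rwa [cbIter_zero, cbIter_zero]
  | add_one γ ih =>
    intro C hC hPC
    rw [cbIter_add_one, mem_cbDeriv] at hC ⊢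
    refine (hC.and_eventually (eventually_forall_lt (φ C))).mono fun n ⟨⟨h1, h2⟩, h3⟩ => ⟨h3, ?_⟩
    obtain ⟨h4, h5⟩ := hP C hPC n h1
    rw [← h5]
    exact ih _ h2 h4
  | limit γ hγ ih =>
    intro C hC hPC
    rw [mem_cbIter_limit _ hγ] at hC ⊢
    exact fun ζ hζ => ih ζ hζ C (hC ζ hζ) hPC

theorem cbIter_mono {F G : Set (Finset ℕ+)} (h : F ⊆ G) (γ : Ordinal.{0}) :
    cbIter F γ ⊆ cbIter G γ := fun C hC =>
  map_mem_cbIter (fun _ => True) id (fun _ _ _ _ => ⟨trivial, rfl⟩) (fun _ hC _ => h hC) γ C hC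
    trivial

/-- Infinitely many extensions distributed over finitely many families fall infinitely often into
one of them. At a limit, the finitely many levels at which membership fails have a supremum still
below the limit. -/
theorem cbIter_biUnion {ι : Type*} (s : Finset ι) (F : ι → Set (Finset ℕ+))
    (hF : ∀ i ∈ s, Hereditary (F i)) (γ : Ordinal.{0}) :
    cbIter (⋃ i ∈ s, F i) γ ⊆ ⋃ i ∈ s, cbIter (F i) γ := by
  induction γ using limitRecOn with
  | zero => simp only [cbIter_zero]; exact le_rfl
  | add_one γ ih =>
    intro A hA
    rw [cbIter_add_one, mem_cbDeriv] at hA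
    by_contra hcon
    simp only [Set.mem_iUnion, not_exists, cbIter_add_one, mem_cbDeriv,
      Filter.not_frequently] at hcon
    have h1 := (Filter.eventually_all_finset s).2 hcon
    obtain ⟨n, ⟨h2, h3⟩, h4⟩ := (hA.and_eventually h1).exists
    obtain ⟨i, hi, h5⟩ := Set.mem_iUnion₂.1 (ih h3)
    exact h4 i hi ⟨h2, h5⟩
  | limit γ hγ ih =>
    intro A hA
    by_contra hcon
    simp only [Set.mem_iUnion, not_exists, mem_cbIter_limit _ hγ, not_forall] at hcon
    choose! g hg using hcon
    have h1 : s.sup g < γ := (Finset.sup_lt_iff hγ.bot_lt).2 fun i hi => (hg i hi).1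
    obtain ⟨i, hi, h2⟩ := Set.mem_iUnion₂.1 (ih _ h1 ((mem_cbIter_limit _ hγ).1 hA _ h1))
    exact (hg i hi).2 ((hF i hi).cbIter_antitone (Finset.le_sup hi) h2)

theorem Hereditary.cbIter_eq_empty {F : Set (Finset ℕ+)} (hF : Hereditary F) {γ : Ordinal.{0}}
    (h : ∅ ∉ Schreier.cbIter F γ) : Schreier.cbIter F γ = ∅ :=
  Set.eq_empty_of_forall_notMem fun A hA => h (hF.cbIter γ A hA _ (Finset.empty_subset A))

/-- Derivatives only look at larger points, so the minimum `m` of `A` stays fixed. At a successor,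
erasing `m` lowers the order by one. At a limit, only the finitely many families with `n ≤ m`
matter. -/
theorem notMem_cbIter_fine (hβ : IsEpsilonSeq β) {α : Ordinal.{0}} (hα : α < ω₁) {A : Finset ℕ+}
    (hA : A.Nonempty) : A ∉ cbIter (fine β α) α := by
  induction α, hα using countable_induction generalizing A with
  | zero => simpa [cbIter_zero, fine_zero] using hA.ne_empty
  | add_one α h ih =>
    intro hmem
    rw [cbIter_add_one, mem_cbDeriv] at hmem
    obtain ⟨n, hn, hmem⟩ := hmem.exists
    have hm := A.min'_mem hA
    set m := A.min' hA
    -- The point `n` gained from the last derivative keeps the set nonempty after `m` is erased.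
    refine ih (A := (insert n A).erase m) ⟨n, by simp [(hn m hm).ne']⟩
      (map_mem_cbIter (fun C => m ∈ C ∧ ∀ c ∈ C, m ≤ c) (fun C => C.erase m) ?_ ?_ α _ hmem
        ⟨Finset.mem_insert_of_mem hm, ?_⟩)
    · rintro C ⟨h1, h2⟩ k hk
      refine ⟨⟨Finset.mem_insert_of_mem h1, ?_⟩, Finset.erase_insert_of_ne (hk m h1).ne'⟩
      intro c hc
      rcases Finset.mem_insert.1 hc with rfl | hc
      · exact (hk m h1).le
      · exact h2 c hc
    · rintro C hC ⟨h1, h2⟩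
      exact erase_min_mem_fine hβ h hC h1 h2
    · intro c hc
      rcases Finset.mem_insert.1 hc with rfl | hc
      · exact (hn m hm).le
      · exact A.min'_le c hc
  | limit α h1 h ih =>
    intro hmem
    have hm := A.min'_mem hA
    set m := A.min' hA with hmdef
    have h2 : A ∈ cbIter (⋃ n ∈ Finset.Icc 1 m, fine β (fundSeq β α n)) α := by
      refine map_mem_cbIter (fun C => m ∈ C) id (fun C hC n _ =>
        ⟨Finset.mem_insert_of_mem hC, rfl⟩) (fun C hC hmC => ?_) α A hmem hm
      obtain ⟨n, hn, hC⟩ := (mem_fine_limit hβ h1 h).1 hC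
      exact Set.mem_iUnion₂.2 ⟨n, by simpa using hn m hmC, hC⟩
    have hher (n : ℕ+) : Hereditary (fine β (fundSeq β α n)) :=
      fine_hereditary hβ ((fundSeq_lt hβ h1 h n).trans h1)
    obtain ⟨n, -, h3⟩ := Set.mem_iUnion₂.1 (cbIter_biUnion _ _ (fun n _ => hher n) α h2)
    exact ih _ (fundSeq_lt hβ h1 h n) hA
      ((hher n).cbIter_antitone (fundSeq_lt hβ h1 h n).le h3)

theorem cbIndex_eq_add_one (hβ : IsEpsilonSeq β) {α : Ordinal.{0}} (hα : α < ω₁)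
    {F : Set (Finset ℕ+)} (hF : Hereditary F) (hsub : F ⊆ fine β α) (h0 : ∅ ∈ cbIter F α) :
    cbIndex F = α + 1 := by
  apply le_antisymm
  · refine csInf_le' (Or.inl (Set.eq_empty_of_forall_notMem fun A hA => ?_))
    rw [cbIter_add_one, mem_cbDeriv] at hA
    obtain ⟨n, -, hA⟩ := hA.exists
    exact notMem_cbIter_fine hβ hα (Finset.insert_nonempty n A) (cbIter_mono hsub α hA)
  · refine le_csInf ⟨ω₁, Or.inr rfl⟩ ?_
    rintro γ (h | rfl)
    · by_contra hlt
      have := hF.cbIter_antitone (lt_add_one_iff.1 (not_le.1 hlt)) h0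
      simp [h] at this
    · exact (add_one_lt_omega_one hα).le

/-! ### Diagonalization -/

/-- Choose points one at a time, shrinking the remaining infinite set after each choice `p` so that
it satisfies `Q p`; everything chosen later lies in it. -/
theorem exists_diagonal (Q : ℕ+ → Set ℕ+ → Prop) (hmono : ∀ p, Antitone (Q p))
    (hQ : ∀ p, ∀ M : Set ℕ+, M.Infinite → ∃ N ⊆ M, N.Infinite ∧ Q p N) {M : Set ℕ+}
    (hM : M.Infinite) :
    ∃ N ⊆ M, N.Infinite ∧ ∀ p ∈ N, Q p (N ∩ Set.Ioi p) := by
  have hstep : ∀ S : {S : Set ℕ+ // S.Infinite}, ∃ (p : ℕ+) (T : {S : Set ℕ+ // S.Infinite}),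
      p ∈ S.1 ∧ T.1 ⊆ S.1 ∧ T.1 ⊆ Set.Ioi p ∧ Q p T.1 := by
    rintro ⟨S, hS⟩
    obtain ⟨p, hp⟩ := hS.nonempty
    have h1 : (S \ Set.Iic p).Infinite := hS.sdiff (Set.finite_Iic p)
    obtain ⟨N, hN, hinf, hQN⟩ := hQ p _ h1
    exact ⟨p, ⟨N, hinf⟩, hp, fun x hx => (hN hx).1, fun x hx => Set.mem_Ioi.2 (not_le.1 (hN hx).2), hQN⟩
  choose p T hp hT1 hT2 hT3 using hstep
  let S : ℕ → {S : Set ℕ+ // S.Infinite} := fun i => T^[i] ⟨M, hM⟩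
  have hS (i : ℕ) : S (i + 1) = T (S i) := Function.iterate_succ_apply' _ _ _
  have hanti : Antitone fun i => (S i).1 := antitone_nat_of_succ_le fun i => by
    simp only [hS]
    exact hT1 _
  have hlt {i j : ℕ} (hij : i < j) : p (S j) ∈ (T (S i)).1 := by
    rw [← hS]
    exact hanti (Nat.succ_le_of_lt hij) (hp _)
  have hmonop : StrictMono fun i => p (S i) := fun i j hij => hT2 _ (hlt hij)
  refine ⟨Set.range fun i => p (S i), ?_, Set.infinite_range_of_injective hmonop.injective, ?_⟩
  · rintro _ ⟨i, rfl⟩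
    exact hanti (Nat.zero_le i) (hp _)
  · rintro _ ⟨i, rfl⟩
    refine hmono _ ?_ (hT3 (S i))
    rintro _ ⟨⟨j, rfl⟩, hj⟩
    exact hlt (hmonop.lt_iff_lt.1 hj)

theorem exists_infinite_forall_finset {ι : Type*} (s : Finset ι) (Q : ι → Set ℕ+ → Prop)
    (hmono : ∀ i, Antitone (Q i))
    (hQ : ∀ i ∈ s, ∀ M : Set ℕ+, M.Infinite → ∃ N ⊆ M, N.Infinite ∧ Q i N) {M : Set ℕ+}
    (hM : M.Infinite) : ∃ N ⊆ M, N.Infinite ∧ ∀ i ∈ s, Q i N := by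
  classical
  induction s using Finset.induction_on with
  | empty => exact ⟨M, le_rfl, hM, by simp⟩
  | insert i s _ ih =>
    obtain ⟨N, hN, hinf, h⟩ := ih fun j hj => hQ j (Finset.mem_insert_of_mem hj)
    obtain ⟨N', hN', hinf', h'⟩ := hQ i (Finset.mem_insert_self i s) N hinf
    refine ⟨N', hN'.trans hN, hinf', fun j hj => ?_⟩
    rcases Finset.mem_insert.1 hj with rfl | hj
    · exact h'
    · exact hmono j hN' (h j hj)

/-! ### Sets with small mass -/

/-- Members of `F` have mass less than `ε` with respect to the repeated averages `P_{(α, B)}` for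
`B ⊆ N`. -/
def IsSmallOn (β : Ordinal.{0} → ℕ+ → Ordinal.{0}) (α : Ordinal.{0}) (F : Set (Finset ℕ+))
    (ε : ℝ) (N : Set ℕ+) : Prop :=
  ∀ B ∈ maxFam (schreier β α), (B : Set ℕ+) ⊆ N → ∀ A ∈ F, A ⊆ B → mass β α B A < ε

theorem isSmallOn_antitone (α : Ordinal.{0}) (F : Set (Finset ℕ+)) (ε : ℝ) :
    Antitone (IsSmallOn β α F ε) := fun _ _ h hN B hB hBN => hN B hB (hBN.trans h)

/-- The potential `r` pays for exceptional blocks: its decrements telescope to at most `k`, and the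
first block costs at most `1`. -/
theorem average_lt {n : ℕ+} {m : Fin (n : ℕ) → ℝ} {r : ℕ → ℕ} {k : ℕ} {ε : ℝ} (hr : r 0 ≤ k)
    (hm : ∀ j : Fin (n : ℕ), m j ≤ (if (j : ℕ) = 0 then 1 else 0) + ε / 2 +
      ((r j : ℝ) - r ((j : ℕ) + 1)))
    (hn : (k + 1 : ℝ) < (n : ℕ) * (ε / 2)) : 1 / ((n : ℕ) : ℝ) * ∑ j, m j < ε := by
  have hn0 : (0 : ℝ) < (n : ℕ) := by exact_mod_cast n.pos
  have h1 : ∑ j, m j ≤ ∑ j ∈ Finset.range n, ((if j = 0 then (1 : ℝ) else 0) + ε / 2 +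
      ((r j : ℝ) - r (j + 1))) := by
    rw [← Fin.sum_univ_eq_sum_range]
    exact Finset.sum_le_sum fun j _ => hm j
  rw [Finset.sum_add_distrib, Finset.sum_add_distrib, Finset.sum_range_sub',
    Finset.sum_ite_eq', if_pos (by simp), Finset.sum_const, Finset.card_range,
    _root_.nsmul_eq_mul] at h1
  have h2 : (r 0 : ℝ) ≤ k := by exact_mod_cast hr
  have h3 : (0 : ℝ) ≤ r n := Nat.cast_nonneg _
  rw [one_div, inv_mul_lt_iff₀ hn0]
  linarith

theorem exists_pnat_gt {ε : ℝ} (hε : 0 < ε) (k : ℕ) :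
    ∃ L : ℕ+, ∀ n : ℕ+, L < n → (k + 1 : ℝ) < (n : ℕ) * (ε / 2) := by
  obtain ⟨l, hl⟩ := exists_nat_gt ((k + 1 : ℝ) / (ε / 2))
  refine ⟨l.succPNat, fun n hn => ?_⟩
  rw [div_lt_iff₀ (by linarith)] at hl
  refine hl.trans_le (mul_le_mul_of_nonneg_right ?_ (by linarith))
  have : (l.succPNat : ℕ) < n := hn
  rw [Nat.succPNat_coe] at this
  exact_mod_cast (by omega : l ≤ (n : ℕ))

theorem infinite_inter_Ioi {M : Set ℕ+} (hM : M.Infinite) (L : ℕ+) : (M ∩ Set.Ioi L).Infinite := by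
  convert hM.sdiff (Set.finite_Iic L) using 1
  ext x
  simp

theorem exists_isSmallOn_zero (hβ : IsEpsilonSeq β) {F : Set (Finset ℕ+)}
    (h0 : ∅ ∉ cbIter F (ω ^ (0 : Ordinal.{0}))) {ε : ℝ} (hε : 0 < ε) {M : Set ℕ+}
    (hM : M.Infinite) : ∃ N ⊆ M, N.Infinite ∧ IsSmallOn β 0 F ε N := by
  rw [opow_zero, ← zero_add 1, cbIter_add_one, cbIter_zero] at h0
  have hfin : {n : ℕ+ | {n} ∈ F}.Finite := by
    by_contra h
    exact h0 (by simpa [cbDeriv] using h)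
  refine ⟨M \ {n : ℕ+ | {n} ∈ F}, Set.sdiff_subset, hM.sdiff hfin, fun B hB hBN A hA hAB => ?_⟩
  have h : B ∈ schreier β 0 := hB.1
  have hne := nonempty_of_mem_maxFam_schreier hβ (omega_pos 1) hB
  rw [schreier_zero] at h
  rcases h with ⟨n, rfl⟩ | rfl
  · rcases Finset.subset_singleton_iff.1 hAB with rfl | rfl
    · simpa [mass] using hε
    · exact absurd hA (hBN (by simp)).2
  · simp at hne

/-- A block on which the potential `r` does not drop adds to a set `U ∈ D l \ D (l + 1)` a piece
keeping it in `D l`. The pieces possible for given `U` and `l` form a family whose derivative of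
order `ω ^ α` omits `∅`, since otherwise `U ∈ D (l + 1)`. -/
theorem exists_isSmallOn_add_one (hβ : IsEpsilonSeq β) {α : Ordinal.{0}} (hα : α + 1 < ω₁)
    (ih : ∀ G : Set (Finset ℕ+), Hereditary G → ∅ ∉ cbIter G (ω ^ α) → ∀ ε : ℝ, 0 < ε →
      ∀ M : Set ℕ+, M.Infinite → ∃ N ⊆ M, N.Infinite ∧ IsSmallOn β α G ε N)
    {F : Set (Finset ℕ+)} (hF : Hereditary F) (h0 : ∅ ∉ cbIter F (ω ^ (α + 1))) {ε : ℝ}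
    (hε : 0 < ε) {M : Set ℕ+} (hM : M.Infinite) :
    ∃ N ⊆ M, N.Infinite ∧ IsSmallOn β (α + 1) F ε N := by
  classical
  have hα' : α < ω₁ := (lt_add_one α).trans hα
  let D : ℕ → Set (Finset ℕ+) := fun i => cbIter F (ω ^ α * (i : Ordinal))
  have hD (i : ℕ) : Hereditary (D i) := hF.cbIter _
  have hD0 : D 0 = F := by simp [D, cbIter_zero]
  have hDsucc (i : ℕ) : cbIter (D i) (ω ^ α) = D (i + 1) := by
    simp only [D]
    rw [hF.cbIter_add, Nat.cast_succ, mul_add_one]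
  obtain ⟨k, hk⟩ : ∃ k : ℕ, D k = ∅ := by
    rw [mem_cbIter_limit _ (isSuccLimit_omega0_opow (by simp))] at h0
    push Not at h0
    obtain ⟨γ, hγ, h0⟩ := h0
    rw [opow_add_one] at hγ
    obtain ⟨c, hc, hγc⟩ := (lt_mul_iff_of_isSuccLimit isSuccLimit_omega0).1 hγ
    obtain ⟨k, rfl⟩ := lt_omega0.1 hc
    exact ⟨k, hF.cbIter_eq_empty fun h => h0 (hF.cbIter_antitone hγc.le h)⟩
  -- Only finitely many pairs of a level and a set of points up to `p` occur, so the union of their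
  -- families still has small rank.
  let s : ℕ+ → Finset (ℕ × Finset ℕ+) := fun p =>
    (Finset.range k ×ˢ (Finset.Icc 1 p).powerset).filter fun x => x.2 ∉ D (x.1 + 1)
  let H : ℕ+ → ℕ × Finset ℕ+ → Set (Finset ℕ+) := fun p x =>
    {C | (∀ c ∈ C, p < c) ∧ x.2 ∪ C ∈ D x.1}
  have hH (p x) : Hereditary (H p x) := fun C hC C' hC' =>
    ⟨fun c hc => hC.1 c (hC' hc), hD _ _ hC.2 _ (Finset.union_subset_union_right hC')⟩
  have hG (p) : Hereditary (⋃ x ∈ s p, H p x) := by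
    intro C hC C' hC'
    obtain ⟨x, hx, hC⟩ := Set.mem_iUnion₂.1 hC
    exact Set.mem_iUnion₂.2 ⟨x, hx, hH p x C hC C' hC'⟩
  have hG0 (p) : ∅ ∉ cbIter (⋃ x ∈ s p, H p x) (ω ^ α) := by
    intro h
    obtain ⟨x, hx, h⟩ := Set.mem_iUnion₂.1 (cbIter_biUnion _ _ (fun x _ => hH p x) _ h)
    have h1 := map_mem_cbIter (G := D x.1) (fun _ => True) (fun C => x.2 ∪ C)
      (fun C _ n _ => ⟨trivial, Finset.union_insert n x.2 C⟩) (fun C hC _ => hC.2) _ _ h trivial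
    rw [hDsucc, Finset.union_empty] at h1
    exact (Finset.mem_filter.1 hx).2 h1
  obtain ⟨L, hL⟩ := exists_pnat_gt hε k
  obtain ⟨N, hN, hinf, hQ⟩ := exists_diagonal
    (fun p N => IsSmallOn β α (⋃ x ∈ s p, H p x) (ε / 2) N) (fun p => isSmallOn_antitone _ _ _)
    (fun p M hM => ih _ (hG p) (hG0 p) _ (half_pos hε) M hM) (infinite_inter_Ioi hM L)
  refine ⟨N, hN.trans Set.inter_subset_left, hinf, fun B hB hBN A hA hAB => ?_⟩
  obtain ⟨n, E, hE, hmass⟩ := exists_mass_add_one hβ hα hB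
  have hEB (j) : E j ⊆ B := by
    rw [← hE.union_eq]
    exact Finset.subset_biUnion_of_mem E (Finset.mem_univ j)
  rw [hmass]
  let U : ℕ → Finset ℕ+ := fun j =>
    A ∩ (Finset.univ.filter fun i : Fin (n : ℕ) => (i : ℕ) < j).biUnion E
  have hU (j) : U j ⊆ U (j + 1) := by
    refine Finset.inter_subset_inter_left (Finset.biUnion_subset_biUnion_of_subset_left _ ?_)
    intro i hi
    simp only [Finset.mem_filter, Finset.mem_univ, true_and] at hi ⊢
    omega
  have hUsucc (j : Fin (n : ℕ)) : U (j + 1) ⊆ U j ∪ (A ∩ E j) := by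
    intro a ha
    simp only [U, Finset.mem_inter, Finset.mem_biUnion, Finset.mem_filter, Finset.mem_univ,
      true_and, Finset.mem_union] at ha ⊢
    obtain ⟨haA, i, hi, hai⟩ := ha
    rcases (Nat.lt_succ_iff.1 hi).lt_or_eq with h | h
    · exact Or.inl ⟨haA, i, h, hai⟩
    · exact Or.inr ⟨haA, by rwa [← Fin.ext h]⟩
  let r : ℕ → ℕ := fun j => ((Finset.range k).filter fun i => U j ∈ D i).card
  have hrsub (j) : ((Finset.range k).filter fun i => U (j + 1) ∈ D i) ⊆
      (Finset.range k).filter fun i => U j ∈ D i :=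
    Finset.monotone_filter_right _ fun i _ h => hD i _ h _ (hU j)
  have hr0 : r 0 ≤ k := (Finset.card_filter_le _ _).trans_eq (Finset.card_range k)
  refine average_lt hr0 (fun j => ?_) (hL n (hN (hBN hE.isLeast.1)).2)
  have hranti : (r (j + 1) : ℝ) ≤ r j := by exact_mod_cast Finset.card_le_card (hrsub j)
  have hle := mass_le_one hβ hα' (hE.mem_max j) A
  split_ifs with hj
  · linarith
  by_cases hlt : r (j + 1) < r j
  · have : (r (j + 1) : ℝ) + 1 ≤ r j := by exact_mod_cast hlt
    linarith
  suffices h : mass β α (E j) (A ∩ E j) < ε / 2 by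
    rw [mass_inter] at h
    linarith
  have heq := Finset.eq_of_subset_of_card_le (hrsub j) (not_lt.1 hlt)
  -- Let `p` be the last point of the preceding block: all of `U j` lies in `[1, p]` and `E j`
  -- beyond `p`, so the diagonal property at `p` applies to `E j`.
  let i : Fin (n : ℕ) := ⟨j - 1, by omega⟩
  have hij : i < j := by
    rw [Fin.lt_def]
    change (j : ℕ) - 1 < j
    omega
  have hne := nonempty_of_mem_maxFam_schreier hβ hα' (hE.mem_max i)
  have hp := (E i).max'_mem hne
  set p := (E i).max' hne
  have hpj : ∀ b ∈ E j, p < b := hE.lt i j hij p hp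
  have hUp : U j ⊆ Finset.Icc 1 p := by
    intro a ha
    simp only [U, Finset.mem_inter, Finset.mem_biUnion, Finset.mem_filter, Finset.mem_univ,
      true_and] at ha
    obtain ⟨-, l, hl, hal⟩ := ha
    rw [Finset.mem_Icc]
    refine ⟨one_le, ?_⟩
    have hli : (l : ℕ) ≤ i := Nat.le_sub_one_of_lt hl
    rcases hli.lt_or_eq with h | h
    · exact (hE.lt l i h a hal p hp).le
    · rw [Fin.ext h] at hal
      exact (E i).le_max' a hal
  have hUF : U j ∈ D 0 := by
    rw [hD0]
    exact hF A hA _ Finset.inter_subset_left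
  obtain ⟨l, hl, hUl, hUl'⟩ : ∃ l < k, U j ∈ D l ∧ U j ∉ D (l + 1) := by
    by_contra! hcon
    have hall : ∀ l ≤ k, U j ∈ D l := by
      intro l
      induction l with
      | zero => exact fun _ => hUF
      | succ l ihl => exact fun h => hcon l h (ihl (Nat.le_of_succ_le h))
    have := hall k le_rfl
    rw [hk] at this
    exact this
  have hUl1 : U (j + 1) ∈ D l := by
    have : l ∈ (Finset.range k).filter fun i => U j ∈ D i :=
      Finset.mem_filter.2 ⟨Finset.mem_range.2 hl, hUl⟩
    rw [← heq] at this
    exact (Finset.mem_filter.1 this).2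
  refine hQ p (hBN (hEB i hp)) (E j) (hE.mem_max j)
    (fun b hb => ⟨hBN (hEB j hb), hpj b hb⟩) _ ?_ Finset.inter_subset_right
  refine Set.mem_iUnion₂.2 ⟨(l, U j), ?_, fun c hc => hpj c (Finset.mem_inter.1 hc).2, ?_⟩
  · simp only [s, Finset.mem_filter, Finset.mem_product, Finset.mem_range, Finset.mem_powerset]
    exact ⟨⟨hl, hUp⟩, hUl'⟩
  · refine hD l _ hUl1 _ (Finset.union_subset (hU j) fun a ha => ?_)
    simp only [U, Finset.mem_inter, Finset.mem_biUnion, Finset.mem_filter, Finset.mem_univ,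
      true_and] at ha ⊢
    exact ⟨ha.1, j, Nat.lt_succ_self _, ha.2⟩

/-- For `B ∈ MAX (schreier β α)`, the measure `P_{(α, B)}` is `P_{(ζ, B)}` for a non-limit ordinal
`ζ` from a finite set which is determined by any element of `B`. -/
theorem exists_finset_reduction (hβ : IsEpsilonSeq β) {α : Ordinal.{0}} (hα : α < ω₁) (b : ℕ+) :
    ∃ R : Finset Ordinal.{0}, (∀ ζ ∈ R, ζ ≤ α ∧ ¬ IsSuccLimit ζ) ∧
      ∀ B ∈ maxFam (schreier β α), b ∈ B →
        ∃ ζ ∈ R, B ∈ maxFam (schreier β ζ) ∧ ∀ A, mass β α B A = mass β ζ B A := by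
  classical
  induction α, hα using countable_induction with
  | zero =>
    refine ⟨{0}, by simp, fun B hB _ => ⟨0, by simp, hB, fun _ => rfl⟩⟩
  | add_one α h ih =>
    refine ⟨{α + 1}, ?_, fun B hB _ => ⟨α + 1, by simp, hB, fun _ => rfl⟩⟩
    intro ζ hζ
    rw [Finset.mem_singleton.1 hζ]
    exact ⟨le_rfl, not_isSuccLimit_add_one α⟩
  | limit α h1 h ih =>
    choose R hR1 hR2 using fun n : ℕ+ => ih _ (schreierSeq_lt hβ h1 h n)
    refine ⟨(Finset.Icc 1 b).biUnion R, fun ζ hζ => ?_, fun B hB hb => ?_⟩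
    · obtain ⟨n, -, hζ⟩ := Finset.mem_biUnion.1 hζ
      exact ⟨(hR1 n ζ hζ).1.trans (schreierSeq_lt hβ h1 h n).le, (hR1 n ζ hζ).2⟩
    · obtain ⟨n, hn, hmax, hmass⟩ := exists_mass_limit hβ h1 h hB
      obtain ⟨ζ, hζ, hmax', hmass'⟩ := hR2 n B hmax hb
      exact ⟨ζ, Finset.mem_biUnion.2 ⟨n, by simpa using hn b hb, hζ⟩, hmax',
        fun A => (hmass A).trans (hmass' A)⟩

/-- Diagonalization at `b = min B` controls only sets beyond `b`. Hence for an order `ζ + 1` the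
induction hypothesis is used at `ζ`, block by block, and the first block is bounded trivially. -/
theorem exists_isSmallOn_limit (hβ : IsEpsilonSeq β) {α : Ordinal.{0}} (hα : α < ω₁)
    (hlim : IsSuccLimit α)
    (ih : ∀ ζ < α, ∀ G : Set (Finset ℕ+), Hereditary G → ∅ ∉ cbIter G (ω ^ ζ) → ∀ ε : ℝ, 0 < ε →
      ∀ M : Set ℕ+, M.Infinite → ∃ N ⊆ M, N.Infinite ∧ IsSmallOn β ζ G ε N)
    {F : Set (Finset ℕ+)} (hF : Hereditary F) (h0 : ∅ ∉ cbIter F (ω ^ α)) {ε : ℝ}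
    (hε : 0 < ε) {M : Set ℕ+} (hM : M.Infinite) :
    ∃ N ⊆ M, N.Infinite ∧ IsSmallOn β α F ε N := by
  classical
  have hlim' : IsSuccLimit (ω ^ α) := isSuccLimit_opow one_lt_omega0 hlim
  obtain ⟨η, hη, h0⟩ : ∃ η < α, ∅ ∉ cbIter F (ω ^ η) := by
    rw [mem_cbIter_limit _ hlim'] at h0
    push Not at h0
    obtain ⟨γ, hγ, h0⟩ := h0
    obtain ⟨η, hη, hγη⟩ := (lt_opow_of_isSuccLimit omega0_ne_zero hlim).1 hγ
    exact ⟨η, hη, fun h => h0 (hF.cbIter_antitone hγη.le h)⟩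
  -- The extra `1` leaves room for `min B`, which is put back after the remaining points of `B` are
  -- seen to lie in `schreier β η`.
  have hη1 : ω ^ η + 1 < ω ^ α :=
    hlim'.succ_lt ((opow_lt_opow_iff_right one_lt_omega0).2 hη)
  obtain ⟨n₀, hn₀⟩ := exists_notMem_maxFam hβ (opow_lt_omega_one hα) hη1
  obtain ⟨L, hL⟩ := exists_pnat_gt hε 0
  choose R hR1 hR2 using exists_finset_reduction hβ hα
  let Q : Ordinal.{0} → Set ℕ+ → Prop := fun ζ N =>
    (∀ ζ', ζ = ζ' + 1 → η ≤ ζ' → IsSmallOn β ζ' F (ε / 2) N) ∧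
      (ζ ≤ η → ∀ A ∈ schreier β ζ, (A : Set ℕ+) ⊆ N → A ∈ schreier β η)
  have hQanti (ζ) : Antitone (Q ζ) := fun _ _ h hQ =>
    ⟨fun ζ' h1 h2 => isSmallOn_antitone _ _ _ h (hQ.1 ζ' h1 h2),
      fun h1 A hA hAN => hQ.2 h1 A hA (hAN.trans h)⟩
  have hQex (p : ℕ+) : ∀ ζ ∈ R p, ∀ M : Set ℕ+, M.Infinite → ∃ N ⊆ M, N.Infinite ∧ Q ζ N := by
    intro ζ hζ M hM
    by_cases hle : ζ ≤ η
    · obtain ⟨N₀, hN₀⟩ := exists_fine_subset hβ (opow_lt_omega_one (hη.trans hα)) (ω ^ ζ)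
        ((opow_le_opow_iff_right one_lt_omega0).2 hle)
      refine ⟨M ∩ Set.Ioi N₀, Set.inter_subset_left, infinite_inter_Ioi hM N₀, ?_, ?_⟩
      · rintro ζ' rfl h
        exact absurd ((lt_add_one ζ').trans_le (hle.trans h)) (lt_irrefl _)
      · exact fun _ A hA hAN => hN₀ A hA fun a ha => le_of_lt (hAN ha).2
    · rcases zero_or_add_one_or_isSuccLimit ζ with rfl | ⟨ζ', rfl⟩ | h
      · exact absurd zero_le hle
      · have hηζ : η ≤ ζ' := lt_add_one_iff.1 (not_le.1 hle)
        obtain ⟨N, hN, hinf, hsmall⟩ := ih ζ' ((lt_add_one ζ').trans_le (hR1 p _ hζ).1) F hF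
          (fun h => h0 (hF.cbIter_antitone
            ((opow_le_opow_iff_right one_lt_omega0).2 hηζ) h)) _ (half_pos hε) M hM
        refine ⟨N, hN, hinf, fun ζ'' h _ => ?_, fun h => absurd h hle⟩
        obtain rfl : ζ' = ζ'' := by simpa using h
        exact hsmall
      · exact absurd h (hR1 p ζ hζ).2
  obtain ⟨N, hN, hinf, hQ⟩ := exists_diagonal (fun p N => ∀ ζ ∈ R p, Q ζ N)
    (fun p _ _ h hQ ζ hζ => hQanti ζ h (hQ ζ hζ))
    (fun p M hM => exists_infinite_forall_finset (R p) Q hQanti (hQex p) hM)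
    (infinite_inter_Ioi hM (max n₀ L))
  refine ⟨N, hN.trans Set.inter_subset_left, hinf, fun B hB hBN A hA hAB => ?_⟩
  have hne := nonempty_of_mem_maxFam_schreier hβ hα hB
  have hb := B.min'_mem hne
  set b := B.min' hne with hbdef
  have hgt {a : ℕ+} (ha : a ∈ B) : max n₀ L < a := (hN (hBN ha)).2
  obtain ⟨ζ, hζ, hmax, hmass⟩ := hR2 b B hB hb
  obtain ⟨hQ1, hQ2⟩ := hQ b (hBN hb) ζ hζ
  have hζ1 : ζ < ω₁ := (hR1 b ζ hζ).1.trans_lt hα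
  by_cases hle : ζ ≤ η
  · exfalso
    have h1 := hQ2 hle (B.erase b) (schreier_hereditary hβ hζ1 B hmax.1 _
      (Finset.erase_subset _ _)) fun a ha =>
        ⟨hBN (Finset.mem_of_mem_erase ha), B.min'_lt_of_mem_erase_min' hne ha⟩
    have h2 := insert_mem_fine_add_one h1 b
    rw [Finset.insert_erase hb] at h2
    exact hn₀ B h2 (fun a ha => (le_max_left _ _).trans_lt (hgt ha)) hB
  · rcases zero_or_add_one_or_isSuccLimit ζ with rfl | ⟨ζ, rfl⟩ | h
    · exact absurd zero_le hle
    · have hsmall := hQ1 ζ rfl (lt_add_one_iff.1 (not_le.1 hle))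
      obtain ⟨n, E, hE, hmass'⟩ := exists_mass_add_one hβ hζ1 hmax
      have hζ2 : ζ < ω₁ := (lt_add_one ζ).trans hζ1
      have hEB (j) : E j ⊆ B := by
        rw [← hE.union_eq]
        exact Finset.subset_biUnion_of_mem E (Finset.mem_univ j)
      rw [hmass, hmass']
      refine average_lt (r := fun _ => 0) le_rfl (fun j => ?_)
        (by simpa using hL n ((le_max_right _ _).trans_lt (hgt hE.isLeast.1)))
      split_ifs with hj
      · have := mass_le_one hβ hζ2 (hE.mem_max j) A
        simp only [Nat.cast_zero]
        linarith
      · let i : Fin (n : ℕ) := ⟨0, n.pos⟩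
        have hij : i < j := Fin.lt_def.2 (Nat.pos_of_ne_zero hj)
        obtain ⟨c, hc⟩ := nonempty_of_mem_maxFam_schreier hβ hζ2 (hE.mem_max i)
        have h := hsmall (E j) (hE.mem_max j) (fun a ha => ⟨hBN (hEB j ha),
          (B.min'_le c (hEB i hc)).trans_lt (hE.lt i j hij c hc a ha)⟩) (A ∩ E j)
          (hF A hA _ Finset.inter_subset_left) Finset.inter_subset_right
        rw [mass_inter] at h
        simpa using h.le
    · exact absurd h (hR1 b ζ hζ).2

/-- If `∅ ∉ F^(ω ^ α)`, there are arbitrarily thin infinite sets `N` on which the members of `F`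
have small mass with respect to the repeated averages of order `α`. -/
theorem exists_isSmallOn (hβ : IsEpsilonSeq β) {α : Ordinal.{0}} (hα : α < ω₁) :
    ∀ F : Set (Finset ℕ+), Hereditary F → ∅ ∉ cbIter F (ω ^ α) → ∀ ε : ℝ, 0 < ε →
      ∀ M : Set ℕ+, M.Infinite → ∃ N ⊆ M, N.Infinite ∧ IsSmallOn β α F ε N := by
  induction α, hα using countable_induction with
  | zero => exact fun F _ h0 ε hε M hM => exists_isSmallOn_zero hβ h0 hε hM
  | add_one α h ih => exact fun F hF h0 ε hε M hM => exists_isSmallOn_add_one hβ h ih hF h0 hε hM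
  | limit α h1 h ih =>
    exact fun F hF h0 ε hε M hM => exists_isSmallOn_limit hβ h1 h ih hF h0 hε hM

/-! ### The sets on which `f_B` is large -/

theorem largeFam_hereditary (hβ : IsEpsilonSeq β) {α : Ordinal.{0}} (hα : α < ω₁)
    (f : Finset ℕ+ → ℕ+ → ℝ) (ρ δ : ℝ) (M : Set ℕ+) : Hereditary (largeFam β α f ρ δ M) := by
  rintro A ⟨⟨h1, h2⟩, B, hB, hAB, h3⟩ A' hA'
  exact ⟨⟨schreier_hereditary hβ hα A h1 A' hA', fun a ha => h2 (hA' ha)⟩, B, hB,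
    hA'.trans hAB, fun a ha => h3 a (hA' ha)⟩

/-- A function bounded by `1` with expectation at least `ρ` is at least `ρ - δ` on a set of mass
at least `δ / (2 + δ)`. -/
theorem le_mass_filter (hβ : IsEpsilonSeq β) {α : Ordinal.{0}} (hα : α < ω₁) {B : Finset ℕ+}
    (hB : B ∈ maxFam (schreier β α)) {g : ℕ+ → ℝ} {ρ δ : ℝ} (hρ : -1 ≤ ρ) (hδ : 0 < δ)
    (hg : ∀ a ∈ B, g a ≤ 1) (hE : ρ ≤ expect β α B g) :
    δ / (2 + δ) ≤ mass β α B {a ∈ B | ρ - δ ≤ g a} := by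
  -- Bound `g` by `1` on the large set and by `ρ - δ` elsewhere: this gives `δ ≤ (1 - ρ + δ) *
  -- mass`, and `1 - ρ + δ ≤ 2 + δ`.
  have h1 : expect β α B g ≤ ∑ a ∈ B, (weight β α B a * (ρ - δ) +
      (if ρ - δ ≤ g a then weight β α B a else 0) * (1 - ρ + δ)) := by
    refine Finset.sum_le_sum fun a ha => ?_
    have hw := weight_nonneg (β := β) α B a
    split_ifs with h
    · nlinarith [hg a ha]
    · nlinarith
  rw [Finset.sum_add_distrib, ← Finset.sum_mul, ← Finset.sum_mul,
    ← Finset.sum_filter] at h1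
  have h2 := mass_self hβ hα hB
  have h3 := mass_nonneg (β := β) α B {a ∈ B | ρ - δ ≤ g a}
  unfold mass at h2 h3 ⊢
  rw [h2] at h1
  rw [div_le_iff₀ (by linarith)]
  nlinarith

end Schreier

theorem corollary4p12 (β : Ordinal.{0} → ℕ+ → Ordinal.{0}) (hβ : Schreier.IsEpsilonSeq β)
    (α : Ordinal.{0}) (hα : α < ω₁)
    (ρ : ℝ) (hρ : ρ ∈ Set.Icc (-1 : ℝ) 1)
    (f : Finset ℕ+ → ℕ+ → ℝ)
    (hf : ∀ A ∈ Schreier.maxFam (Schreier.schreier β α), ∀ a ∈ A, f A a ∈ Set.Icc (-1 : ℝ) 1)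
    (hE : ∀ A ∈ Schreier.maxFam (Schreier.schreier β α), ρ ≤ Schreier.expect β α A (f A))
    (δ : ℝ) (hδ : 0 < δ) (M : Set ℕ+) (hM : M.Infinite) :
    Schreier.cbIndex (Schreier.largeFam β α f ρ δ M) = ω ^ α + 1 := by
  open Schreier in
  have hher := largeFam_hereditary hβ hα f ρ δ M
  refine cbIndex_eq_add_one hβ (opow_lt_omega_one hα) hher (fun A hA => hA.1.1) ?_
  by_contra h0
  obtain ⟨N, hN, hinf, hsmall⟩ := exists_isSmallOn hβ hα _ hher h0 (δ / (2 + δ)) (by positivity)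
    M hM
  obtain ⟨B, hB, hBN⟩ := exists_mem_maxFam_schreier hβ hα hinf
  have hsub : {a ∈ B | ρ - δ ≤ f B a} ⊆ B := Finset.filter_subset _ _
  -- As `B ⊆ M` is maximal among all Schreier sets, it is maximal among those inside `M`, so it
  -- witnesses membership of its own large set.
  refine absurd (hsmall B hB hBN {a ∈ B | ρ - δ ≤ f B a}
    ⟨⟨schreier_hereditary hβ hα B hB.1 _ hsub, fun a ha => hN (hBN (hsub ha))⟩, B,
      ⟨⟨hB.1, hBN.trans hN⟩, fun C hC hBC => hB.2 hC.1 hBC⟩, hsub,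
      fun a ha => (Finset.mem_filter.1 ha).2⟩ hsub) (not_lt.2 ?_)
  exact le_mass_filter hβ hα hB hρ.1 hδ (fun a ha => (hf B hB a ha).2) (hE B hB)
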